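/- There is an absolute constant $c>0$, and for every $M$ there is $\eta=\eta(M)>0$, such that the following holds for every $n\ge 2$. Let $\mu=\mu_1\otimes\cdots\otimes\mu_n$ be a product of probability measures on $\mathbb{R}$, each having mean $0$, variance $1$, third moment of absolute value at most $M$ and (finite) fourth moment at most $M$. For $F\colon\mathbb{R}^n\to\mathbb{R}$ let $$\delta_2(F)=\inf_{S}\ \inf_{F_1,F_2}\ \bigl\|F(x)-F_1(x_S)-F_2(x_{\overline{S}})\bigr\|_{L^2(\mu)},$$ where $S$ ranges over the non-empty proper subsets of $\{1,\dots,n\}$ and $F_1,F_2$ over the measurable real-valued functions of the coordinates in $S$ and in its complement $\overline{S}$, respectively. A non-adaptive $q$-query tester chooses, from its random coins alone, query points $x^1,\dots,x^q\in\mathbb{R}^n$, receives $F(x^1),\dots,F(x^q)$, and accepts or rejects depending on the coins and the answers. It tests $2$-partitionability on a class of functions with proximity parameter $\varepsilon$ if, for every $F$ in the class, it accepts with probability at least $2/3$ when $\delta_2(F)=0$ and rejects with probability at least $2/3$ when $\delta_2(F)>\varepsilon$. A quadratic function is a real polynomial function of total degree at most $2$. Then: 1. for every $\varepsilon>0$,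 every non-adaptive $q$-query tester that tests $2$-partitionability on the class of all quadratic functions $\mathbb{R}^n\to\mathbb{R}$ with proximity parameter $\varepsilon$ satisfies $q\ge c\,n$; 2. for every $0<\varepsilon\le\eta/\sqrt{n}$, the same bound $q\ge c\,n$ already holds for every non-adaptive $q$-query tester that tests $2$-partitionability, with proximity parameter $\varepsilon$, only on the quadratic functions $F$ with $\|F\|_{L^4(\mu)}\le 1$. -/

import Mathlib

open MeasureTheory
open scoped ENNReal

/-- `F : ℝⁿ → ℝ` is a quadratic function: a real polynomial function of total degree at most `2`. -/
def IsQuadratic {n : ℕ} (F : (Fin n → ℝ) → ℝ) : Prop :=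
  ∃ p : MvPolynomial (Fin n) ℝ, p.totalDegree ≤ 2 ∧ ∀ x, F x = MvPolynomial.eval x p

/-- The cost `δ(X_S, X_{Sᶜ})` of the bipartition `(S, Sᶜ)` of the variables of `F`, in the `2`-norm
under the product measure `⨂ᵢ μ i`: the infimum of `‖F - F₁(x_S) - F₂(x_{Sᶜ})‖₂` over all
measurable `F₁`, `F₂`. -/
noncomputable def bipartitionCost {n : ℕ} (μ : Fin n → Measure ℝ) (S : Set (Fin n))
    (F : (Fin n → ℝ) → ℝ) : ℝ≥0∞ :=
  ⨅ (F₁ : (↥S → ℝ) → ℝ) (F₂ : (↥Sᶜ → ℝ) → ℝ) (_ : Measurable F₁) (_ : Measurable F₂),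
    eLpNorm (fun x => F x - F₁ (fun i => x i) - F₂ (fun i => x i)) 2 (Measure.pi μ)

/-- The optimal `2`-partition error `δ₂(F)` in the `2`-norm: the least cost of a partition of the
variables into two non-empty parts. -/
noncomputable def twoPartitionError {n : ℕ} (μ : Fin n → Measure ℝ)
    (F : (Fin n → ℝ) → ℝ) : ℝ≥0∞ :=
  ⨅ (S : Set (Fin n)) (_ : S.Nonempty) (_ : Sᶜ.Nonempty), bipartitionCost μ S F

/-- A randomized non-adaptive tester making `q` queries to a function `ℝⁿ → ℝ`, with random coins
in `Ω`. All queries are determined by the coins alone; the verdict depends on the coins and on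
the `q` answers. -/
structure NonadaptiveTester (Ω : Type*) [MeasurableSpace Ω] (n q : ℕ) where
  /-- the distribution of the random coins -/
  coins : Measure Ω
  isProbabilityMeasure_coins : IsProbabilityMeasure coins
  /-- the query points -/
  query : Ω → Fin q → (Fin n → ℝ)
  measurable_query : Measurable query
  /-- the pairs (coins, answers) on which the tester accepts -/
  accept : Set (Ω × (Fin q → ℝ))
  measurableSet_accept : MeasurableSet accept

/-- The probability that the tester accepts when run with oracle `F`. -/
noncomputable def NonadaptiveTester.acceptProb {Ω : Type*} [MeasurableSpace Ω] {n q : ℕ}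
    (T : NonadaptiveTester Ω n q) (F : (Fin n → ℝ) → ℝ) : ℝ :=
  T.coins.real {ω | (ω, fun i => F (T.query ω i)) ∈ T.accept}

/-- `T` tests `2`-partitionability on the class `C` of inputs in the `2`-norm under `⨂ᵢ μ i` with
proximity parameter `ε` and two-sided error `1/3`: it accepts with probability at least `2/3` if
`δ₂(F) = 0`, and it accepts with probability at most `1/3` if `δ₂(F) > ε`. -/
def NonadaptiveTester.TestsTwoPartitionability {Ω : Type*} [MeasurableSpace Ω] {n q : ℕ}
    (T : NonadaptiveTester Ω n q) (μ : Fin n → Measure ℝ) (C : Set ((Fin n → ℝ) → ℝ))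
    (ε : ℝ) : Prop :=
  ∀ F ∈ C,
    (twoPartitionError μ F = 0 → 2 / 3 ≤ T.acceptProb F) ∧
    (ENNReal.ofReal ε < twoPartitionError μ F → T.acceptProb F ≤ 1 / 3)

/-! The hard instances are random forms `s * ∑_{i<j} a_ij x_i x_j` with independent coefficients
`a_ij`. Their law is supported on `1 ≤ |a_ij| ≤ 2`, so every cut separates at least `n - 1` pairs
with non-negligible coefficients and the form is far from partitionable. Erasing all coefficients
that involve one variable `x_k` makes it partitionable with the part `{k}`. A tester must therefore
tell `a` from each of its `n` erasures.

For fixed coins the queries are fixed, and each answer is a linear functional of `a`. The `q`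
functionals lie in the span of `d ≤ q` orthonormal vectors of total mass `d`. A coefficient position
lies in at most two stars, so the masses on the `n` stars sum to at most `2q`, and a typical star
carries mass `O(q / n)`. If the mass on a star is small, the effect of the erased coefficients on
all answers can be reproduced by a short translation `u` of the remaining ones
(`exists_matching_vector`). The answers are exact reals, so this must be hidden by a smooth
coefficient law: its density is `φ ^ 2` with `φ` Lipschitz in `L²` under translation, and a
Hellinger estimate bounds the change of any probability by `1/6 + O(|u|²)`
(`IsProfile.abs_real_pi_translate_sub_le`). Averaging over stars and coins contradicts the advantage
`1/3` unless `q` is of order `n` (`IsProfile.card_le_of_distinguishes`).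

Two estimates link this to `μ`. A mixed second difference across a cut removes `F₁` and `F₂` and
bounds the partition error below by `s√(n-1)/2` (`ofReal_le_twoPartitionError`). A fourth moment
bound shows that `s` of order `1/n` keeps the `L⁴` norm at most `1`
(`eLpNorm_four_triangularForm_le_one`), which gives the scale `1/√n` for the proximity parameter. -/

/-! ### Smooth coefficient laws and their behaviour under translation -/

theorem one_sub_sum_one_sub_le_prod {ι : Type*} (s : Finset ι) (f : ι → ℝ)
    (h0 : ∀ i, 0 ≤ f i) (h1 : ∀ i, f i ≤ 1) :
    1 - ∑ i ∈ s, (1 - f i) ≤ ∏ i ∈ s, f i := by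
  classical
  induction s using Finset.induction_on with
  | empty => simp
  | insert a s ha ih =>
    rw [Finset.sum_insert ha, Finset.prod_insert ha]
    have hp0 : 0 ≤ ∏ i ∈ s, f i := Finset.prod_nonneg fun i _ => h0 i
    have hp1 : ∏ i ∈ s, f i ≤ 1 := Finset.prod_le_one (fun i _ => h0 i) fun i _ => h1 i
    nlinarith [h0 a, h1 a, mul_nonneg (sub_nonneg.2 (h1 a)) (sub_nonneg.2 hp1)]

/-- A profile: an even, compactly supported square-root density on `ℝ`, supported away from `0`,
that is Lipschitz in `L²` under translations. -/
structure IsProfile (φ : ℝ → ℝ) (C : ℝ) : Prop where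
  continuous : Continuous φ
  nonneg : ∀ t, 0 ≤ φ t
  even : ∀ t, φ (-t) = φ t
  eq_zero : ∀ t, ¬ (1 ≤ |t| ∧ |t| ≤ 2) → φ t = 0
  integral_sq : ∫ t, φ t ^ 2 = 1
  const_nonneg : 0 ≤ C
  integral_sub_sq : ∀ u, ∫ t, (φ (t + u) - φ t) ^ 2 ≤ C * u ^ 2

theorem hasCompactSupport_of_eq_zero {φ : ℝ → ℝ}
    (h : ∀ t, ¬ (1 ≤ |t| ∧ |t| ≤ 2) → φ t = 0) : HasCompactSupport φ := by
  refine HasCompactSupport.intro (K := Set.Icc (-2) 2) isCompact_Icc fun x hx => h x ?_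
  rintro ⟨_, h2⟩
  exact hx (abs_le.1 h2)

/-- Two tents of half-width `1/2` centred at `±3/2`, normalised in `L²`. Since the square root of
the density is itself Lipschitz with compact support, its translates are close in `L²` at quadratic
rate. -/
theorem exists_isProfile : ∃ (φ : ℝ → ℝ) (C : ℝ), IsProfile φ C := by
  let ψ : ℝ → ℝ := fun t => max 0 (1 / 2 - |(|t| - 3 / 2)|)
  have hψc : Continuous ψ := by fun_prop
  have hψ0 : ∀ t, 0 ≤ ψ t := fun t => le_max_left _ _
  have hψz : ∀ t, ¬ (1 ≤ |t| ∧ |t| ≤ 2) → ψ t = 0 := by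
    intro t ht
    refine max_eq_left ?_
    by_contra! h
    have := abs_lt.1 (show |(|t| - 3 / 2)| < 1 / 2 by linarith)
    exact ht ⟨by linarith, by linarith⟩
  have hcs := hasCompactSupport_of_eq_zero hψz
  have hcs2 : HasCompactSupport fun t => ψ t ^ 2 := hcs.comp_left (g := fun y => y ^ 2) (by simp)
  have hlip : ∀ t u, (ψ (t + u) - ψ t) ^ 2 ≤ u ^ 2 := by
    intro t u
    rw [← sq_abs u, ← sq_abs (_ - _)]
    refine pow_le_pow_left₀ (abs_nonneg _) ?_ 2
    calc |ψ (t + u) - ψ t| ≤ |(1 / 2 - |(|t + u| - 3 / 2)|) - (1 / 2 - |(|t| - 3 / 2)|)| := by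
          simpa [ψ, max_comm] using
            abs_max_sub_max_le_abs (1 / 2 - |(|t + u| - 3 / 2)|) (1 / 2 - |(|t| - 3 / 2)|) 0
      _ = abs (abs (|t| - 3 / 2) - abs (|t + u| - 3 / 2)) := by congr 1; ring
      _ ≤ abs ((|t| - 3 / 2) - (|t + u| - 3 / 2)) := abs_abs_sub_abs_le _ _
      _ = abs (|t| - |t + u|) := by congr 1; ring
      _ ≤ |t - (t + u)| := abs_abs_sub_abs_le _ _
      _ = |u| := by rw [sub_add_cancel_left, abs_neg]
  have hI : Integrable fun t => ψ t ^ 2 :=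
    (hψc.pow 2).integrable_of_hasCompactSupport hcs2
  have hpos : 0 < ∫ t, ψ t ^ 2 := by
    refine Continuous.integral_pos_of_hasCompactSupport_nonneg_nonzero (x := 3 / 2) (hψc.pow 2)
      hcs2 (fun t => sq_nonneg _) ?_
    simp only [ψ]
    norm_num [abs_of_pos]
  set I := ∫ t, ψ t ^ 2 with hIdef
  -- The integrand is at most `u ^ 2` and vanishes unless `t` or `t + u` lies in `[-2, 2]`; these
  -- two conditions contribute `4 * u ^ 2` each.
  have hs : ∀ u, ∫ t, (ψ (t + u) - ψ t) ^ 2 ≤ 8 * u ^ 2 := by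
    intro u
    let g : ℝ → ℝ := (Set.Icc (-2) 2).indicator fun _ => u ^ 2
    have hg : Integrable g := by
      refine (integrable_indicator_iff measurableSet_Icc).2 ?_
      exact integrableOn_const (by simp)
    have hgi : ∫ t, g t = 4 * u ^ 2 := by
      rw [integral_indicator measurableSet_Icc]
      simp
      ring_nf; simp
    have hz : ∀ t, t ∉ Set.Icc (-2 : ℝ) 2 → ψ t = 0 := fun t ht =>
      hψz t fun h => ht (abs_le.1 h.2)
    calc ∫ t, (ψ (t + u) - ψ t) ^ 2 ≤ ∫ t, (g (t + u) + g t) := by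
          refine integral_mono_of_nonneg (.of_forall fun t => sq_nonneg _)
            ((hg.comp_add_right u).add hg) (.of_forall fun t => ?_)
          have h1 := hlip t u
          have hu := sq_nonneg u
          by_cases h : t ∈ Set.Icc (-2 : ℝ) 2 <;> by_cases h' : t + u ∈ Set.Icc (-2 : ℝ) 2 <;>
            simp only [g, Set.indicator_of_mem, Set.indicator_of_notMem, h, h', not_false_eq_true]
          · linarith
          · linarith
          · linarith
          · rw [hz _ h, hz _ h']; norm_num
      _ = 8 * u ^ 2 := by
          rw [integral_add (hg.comp_add_right u) hg, integral_add_right_eq_self g u, hgi]; ring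
  refine ⟨fun t => ψ t / √I, 8 / I, ?_, ?_, ?_, ?_, ?_, ?_, ?_⟩
  · fun_prop
  · intro t; exact div_nonneg (hψ0 t) (Real.sqrt_nonneg _)
  · intro t; simp [ψ]
  · intro t ht; simp [hψz t ht]
  · simp_rw [div_pow, Real.sq_sqrt hpos.le]
    rw [integral_div, ← hIdef, div_self hpos.ne']
  · positivity
  · intro u
    simp_rw [← sub_div, div_pow, Real.sq_sqrt hpos.le]
    rw [integral_div, div_mul_eq_mul_div]
    gcongr
    exact hs u

/-- The probability measure with density `φ²`. -/
noncomputable def sqDensity (φ : ℝ → ℝ) : Measure ℝ :=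
  volume.withDensity fun t => ENNReal.ofReal (φ t ^ 2)

namespace IsProfile

variable {φ : ℝ → ℝ} {C : ℝ}

theorem hasCompactSupport (h : IsProfile φ C) : HasCompactSupport φ :=
  hasCompactSupport_of_eq_zero h.eq_zero

theorem integrable_mul (h : IsProfile φ C) (u v : ℝ) :
    Integrable fun t => φ (t + u) * φ (t + v) := by
  have hc := h.continuous
  refine Continuous.integrable_of_hasCompactSupport (by fun_prop) ?_
  exact HasCompactSupport.mul_right (h.hasCompactSupport.comp_homeomorph (Homeomorph.addRight u))

theorem integrable_sq (h : IsProfile φ C) : Integrable fun t => φ t ^ 2 := by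
  simpa [pow_two] using h.integrable_mul 0 0

theorem isProbabilityMeasure (h : IsProfile φ C) : IsProbabilityMeasure (sqDensity φ) := by
  constructor
  rw [sqDensity, withDensity_apply _ MeasurableSet.univ, Measure.restrict_univ,
    ← ofReal_integral_eq_lintegral_ofReal h.integrable_sq (.of_forall fun t => sq_nonneg _),
    h.integral_sq, ENNReal.ofReal_one]

theorem ae_abs_mem (h : IsProfile φ C) : ∀ᵐ t ∂sqDensity φ, 1 ≤ |t| ∧ |t| ≤ 2 := by
  have hm : Measurable fun t => ENNReal.ofReal (φ t ^ 2) :=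
    (h.continuous.measurable.pow_const 2).ennreal_ofReal
  rw [sqDensity, ae_withDensity_iff hm]
  refine .of_forall fun t ht => ?_
  by_contra hc
  exact ht (by simp [h.eq_zero t hc])

theorem integral_eq_zero (h : IsProfile φ C) : ∫ t, t ∂sqDensity φ = 0 := by
  have hm : Measurable fun t => (φ t ^ 2).toNNReal :=
    (h.continuous.measurable.pow_const 2).real_toNNReal
  have : sqDensity φ = volume.withDensity fun t => (((φ t ^ 2).toNNReal : NNReal) : ℝ≥0∞) := rfl
  rw [this, integral_withDensity_eq_integral_smul hm]
  have h1 := integral_neg_eq_self (fun t : ℝ => (φ t ^ 2).toNNReal • t) volume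
  simp only [h.even, smul_neg, integral_neg] at h1
  linarith

/-- The correlation of a profile with its translate is at most one, and at least
`1 - C u ^ 2 / 2`. -/
theorem correlation_bounds (h : IsProfile φ C) (u : ℝ) :
    0 ≤ ∫ t, φ (t + u) * φ t ∧ ∫ t, φ (t + u) * φ t ≤ 1 ∧
      1 - C / 2 * u ^ 2 ≤ ∫ t, φ (t + u) * φ t := by
  have h1 : ∫ t, (φ (t + u) - φ t) ^ 2 = 2 - 2 * ∫ t, φ (t + u) * φ t := by
    have e : ∀ t, (φ (t + u) - φ t) ^ 2 = φ (t + u) ^ 2 + φ t ^ 2 - 2 * (φ (t + u) * φ t) := by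
      intro t; ring
    have i1 := h.integrable_sq.comp_add_right u
    have i2 : Integrable fun t => φ (t + u) * φ t := by simpa using h.integrable_mul u 0
    have i3 : Integrable fun t => φ (t + u) ^ 2 + φ t ^ 2 := i1.add h.integrable_sq
    simp_rw [e]
    rw [integral_sub i3 (i2.const_mul 2), integral_add i1 h.integrable_sq,
      integral_const_mul, integral_add_right_eq_self (fun t => φ t ^ 2) u, h.integral_sq]
    ring
  refine ⟨integral_nonneg fun t => mul_nonneg (h.nonneg _) (h.nonneg _), ?_, ?_⟩
  · have : 0 ≤ ∫ t, (φ (t + u) - φ t) ^ 2 := integral_nonneg fun t => sq_nonneg _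
    linarith
  · linarith [h.integral_sub_sq u]

variable {ι : Type*} [Fintype ι]

theorem integrable_prod_mul (h : IsProfile φ C) (u v : ι → ℝ) :
    Integrable fun a : ι → ℝ => (∏ i, φ (a i + u i)) * ∏ i, φ (a i + v i) := by
  simp_rw [← Finset.prod_mul_distrib]
  exact Integrable.fintype_prod_dep (f := fun i t => φ (t + u i) * φ (t + v i))
    fun i => h.integrable_mul _ _

theorem pi_eq_withDensity (h : IsProfile φ C) :
    Measure.pi (fun _ : ι => sqDensity φ) =
      volume.withDensity fun a => ENNReal.ofReal ((∏ i, φ (a i)) ^ 2) := by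
  have := h.isProbabilityMeasure
  refine Measure.pi_eq fun s hs => ?_
  have hI : Integrable fun a : ι → ℝ => (∏ i, φ (a i)) ^ 2 := by
    simpa [pow_two] using h.integrable_prod_mul (ι := ι) 0 0
  rw [withDensity_apply _ (MeasurableSet.univ_pi hs),
    ← ofReal_integral_eq_lintegral_ofReal hI.integrableOn (.of_forall fun t => sq_nonneg _),
    volume_pi, Measure.restrict_pi_pi]
  simp_rw [← Finset.prod_pow]
  rw [integral_fintype_prod_eq_prod (fun _ t => φ t ^ 2),
    ENNReal.ofReal_prod_of_nonneg fun i _ => integral_nonneg fun t => sq_nonneg _]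
  refine Finset.prod_congr rfl fun i _ => ?_
  rw [sqDensity, withDensity_apply _ (hs i),
    ofReal_integral_eq_lintegral_ofReal h.integrable_sq.integrableOn
      (.of_forall fun t => sq_nonneg _)]

/-- This squared Hellinger-type distance equals `2 - 2ρ`, where `ρ` is the product of the coordinate
correlations. The union-type bound `∏ f ≥ 1 - ∑ (1 - f)` makes the coordinate losses `C/2 * u i ^ 2`
additive. -/
theorem integral_prod_sub_sq_le (h : IsProfile φ C) (u : ι → ℝ) :
    ∫ a : ι → ℝ, ((∏ i, φ (a i + u i)) - ∏ i, φ (a i)) ^ 2 ≤ C * ∑ i, u i ^ 2 := by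
  have i0 : Integrable fun a : ι → ℝ => (∏ i, φ (a i)) ^ 2 := by
    simpa [pow_two] using h.integrable_prod_mul (ι := ι) 0 0
  have i1 : Integrable fun a : ι → ℝ => (∏ i, φ (a i + u i)) ^ 2 := by
    simpa [pow_two] using h.integrable_prod_mul (ι := ι) u u
  have i2 : Integrable fun a : ι → ℝ => (∏ i, φ (a i + u i)) * ∏ i, φ (a i) := by
    simpa using h.integrable_prod_mul (ι := ι) u 0
  have e0 : ∫ a : ι → ℝ, (∏ i, φ (a i)) ^ 2 = 1 := by
    simp_rw [← Finset.prod_pow]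
    rw [integral_fintype_prod_volume_eq_prod (fun _ t => φ t ^ 2)]
    simp [h.integral_sq]
  have e1 : ∫ a : ι → ℝ, (∏ i, φ (a i + u i)) ^ 2 = 1 := by
    rw [← e0]
    exact integral_add_right_eq_self (fun a : ι → ℝ => (∏ i, φ (a i)) ^ 2) u
  have e2 : 1 - C / 2 * ∑ i, u i ^ 2 ≤ ∫ a : ι → ℝ, (∏ i, φ (a i + u i)) * ∏ i, φ (a i) := by
    simp_rw [← Finset.prod_mul_distrib]
    rw [integral_fintype_prod_volume_eq_prod (fun i t => φ (t + u i) * φ t)]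
    refine le_trans ?_ (one_sub_sum_one_sub_le_prod _ _ (fun i => (h.correlation_bounds (u i)).1)
      fun i => (h.correlation_bounds (u i)).2.1)
    rw [Finset.mul_sum]
    refine sub_le_sub_left (Finset.sum_le_sum fun i _ => ?_) 1
    linarith [(h.correlation_bounds (u i)).2.2]
  have e : ∀ a : ι → ℝ, ((∏ i, φ (a i + u i)) - ∏ i, φ (a i)) ^ 2 =
      (∏ i, φ (a i + u i)) ^ 2 + (∏ i, φ (a i)) ^ 2
        - 2 * ((∏ i, φ (a i + u i)) * ∏ i, φ (a i)) := fun a => by ring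
  have i3 : Integrable fun a : ι → ℝ => (∏ i, φ (a i + u i)) ^ 2 + (∏ i, φ (a i)) ^ 2 :=
    i1.add i0
  simp_rw [e]
  rw [integral_sub i3 (i2.const_mul 2), integral_add i1 i0, integral_const_mul, e0, e1]
  linarith

theorem real_pi_apply (h : IsProfile φ C) {D : Set (ι → ℝ)} (hD : MeasurableSet D) :
    (Measure.pi (fun _ : ι => sqDensity φ)).real D =
      ∫ a, D.indicator (fun a => (∏ i, φ (a i)) ^ 2) a := by
  have hI : Integrable fun a : ι → ℝ => (∏ i, φ (a i)) ^ 2 := by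
    simpa [pow_two] using h.integrable_prod_mul (ι := ι) 0 0
  rw [integral_indicator hD, h.pi_eq_withDensity, measureReal_def, withDensity_apply _ hD,
    integral_eq_lintegral_of_nonneg_ae (.of_forall fun t => sq_nonneg _)
      hI.aestronglyMeasurable.restrict]

/-- A translation changes probabilities under a product of profile densities by little. -/
theorem abs_real_pi_translate_sub_le (h : IsProfile φ C) (u : ι → ℝ) {D : Set (ι → ℝ)}
    (hD : MeasurableSet D) :
    |(Measure.pi (fun _ : ι => sqDensity φ)).real ((· + u) ⁻¹' D) -
      (Measure.pi (fun _ : ι => sqDensity φ)).real D| ≤ 1 / 6 + 6 * C * ∑ i, u i ^ 2 := by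
  have hm : Measurable fun a : ι → ℝ => a + u := measurable_add_const u
  set Φ : (ι → ℝ) → ℝ := fun a => ∏ i, φ (a i) with hΦ
  have hI : Integrable fun a : ι → ℝ => Φ a ^ 2 := by
    simpa [pow_two, hΦ] using h.integrable_prod_mul (ι := ι) 0 0
  have hIu : Integrable fun a : ι → ℝ => Φ (a + u) ^ 2 := hI.comp_add_right u
  have hIm : Integrable fun a : ι → ℝ => Φ (a + u) * Φ a := by
    simpa [hΦ] using h.integrable_prod_mul (ι := ι) u 0
  have e0 : ∫ a : ι → ℝ, Φ a ^ 2 = 1 := by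
    simp_rw [hΦ, ← Finset.prod_pow]
    rw [integral_fintype_prod_volume_eq_prod (fun _ t => φ t ^ 2)]
    simp [h.integral_sq]
  have e1 : ∫ a : ι → ℝ, Φ (a + u) ^ 2 = 1 := by
    rw [integral_add_right_eq_self (fun a => Φ a ^ 2) u, e0]
  have hDu : MeasurableSet ((· + u) ⁻¹' D) := hm hD
  -- Translation invariance of Lebesgue measure puts both probabilities on the same set, with
  -- densities `Φ a ^ 2` and `Φ (a + u) ^ 2`.
  have hl : ∫ a, D.indicator (fun a => Φ a ^ 2) a =
      ∫ a, ((· + u) ⁻¹' D).indicator (fun a => Φ (a + u) ^ 2) a :=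
    (integral_add_right_eq_self (D.indicator (fun a => Φ a ^ 2)) u).symm
  rw [h.real_pi_apply hDu, h.real_pi_apply hD, hl,
    ← integral_sub (hI.indicator hDu) (hIu.indicator hDu)]
  have hs := h.integral_prod_sub_sq_le u
  have hsi : Integrable fun a : ι → ℝ => (Φ (a + u) - Φ a) ^ 2 := by
    have := (hIu.add hI).sub (hIm.const_mul 2)
    refine this.congr (.of_forall fun a => ?_)
    simp only [Pi.add_apply, Pi.sub_apply]; ring
  refine abs_integral_le_integral_abs.trans ?_
  calc _ ≤ ∫ a, (6 * (Φ (a + u) - Φ a) ^ 2 + 1 / 12 * (Φ (a + u) ^ 2 + Φ a ^ 2)) := by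
        refine integral_mono_of_nonneg (.of_forall fun a => abs_nonneg _)
          ((hsi.const_mul 6).add ((hIu.add hI).const_mul _)) (.of_forall fun a => ?_)
        -- Factor the difference of squares and apply `|xy| ≤ 6x² + y²/24`. The weights make the
        -- second term integrate to exactly `1/6`, half of the advantage `1/3` of a tester.
        have key : |Φ a ^ 2 - Φ (a + u) ^ 2| ≤
            6 * (Φ (a + u) - Φ a) ^ 2 + 1 / 12 * (Φ (a + u) ^ 2 + Φ a ^ 2) := by
          rw [abs_le]
          constructor <;>
          nlinarith [sq_nonneg (12 * (Φ (a + u) - Φ a) - (Φ (a + u) + Φ a)),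
            sq_nonneg (12 * (Φ (a + u) - Φ a) + (Φ (a + u) + Φ a)),
            sq_nonneg (Φ (a + u) - Φ a)]
        by_cases ha : a ∈ (· + u) ⁻¹' D
        · simpa only [Set.indicator_of_mem ha] using key
        · simp only [Set.indicator_of_notMem ha, sub_zero, abs_zero]; positivity
    _ = 6 * (∫ a, (Φ (a + u) - Φ a) ^ 2) + 1 / 6 := by
        have i3 : Integrable fun a : ι → ℝ => 1 / 12 * (Φ (a + u) ^ 2 + Φ a ^ 2) :=
          (hIu.add hI).const_mul _
        rw [integral_add (hsi.const_mul 6) i3, integral_const_mul, integral_const_mul,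
          integral_add hIu hI, e0, e1]
        norm_num
    _ ≤ _ := by
        have : ∫ a, (Φ (a + u) - Φ a) ^ 2 ≤ C * ∑ i, u i ^ 2 := hs
        rw [mul_assoc]; linarith

end IsProfile

/-! ### Linear measurements and their mass on sets of coordinates -/

/-- Finitely many vectors `r` lie in the span of an orthonormal family of at most as many
vectors. -/
theorem exists_orthonormal_family_spanning {ι : Type*} [Fintype ι] {q : ℕ} (r : Fin q → ι → ℝ) :
    ∃ d ≤ q, ∃ (b : Fin d → ι → ℝ) (g : Fin q → Fin d → ℝ),
      (∀ i j, ∑ e, b i e * b j e = if i = j then 1 else 0) ∧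
      ∀ k e, r k e = ∑ i, g k i * b i e := by
  let r' : Fin q → EuclideanSpace ℝ ι := fun k => WithLp.toLp 2 (r k)
  have hd : Module.finrank ℝ (Submodule.span ℝ (Set.range r')) ≤ q := by
    have h : (Set.range r').finrank ℝ ≤ Fintype.card (Fin q) := finrank_range_le_card r'
    rwa [Fintype.card_fin] at h
  have hr : ∀ k, r' k ∈ Submodule.span ℝ (Set.range r') :=
    fun k => Submodule.subset_span ⟨k, rfl⟩
  generalize Submodule.span ℝ (Set.range r') = V at hd hr
  let B := stdOrthonormalBasis ℝ V
  refine ⟨Module.finrank ℝ V, hd, fun i e => (B i : EuclideanSpace ℝ ι) e,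
    fun k i => B.repr ⟨r' k, hr k⟩ i, ?_, ?_⟩
  · intro i j
    have h := (orthonormal_iff_ite.1 B.orthonormal) i j
    rw [Submodule.coe_inner, PiLp.inner_apply] at h
    rw [← h]
    refine Finset.sum_congr rfl fun e _ => ?_
    rw [RCLike.inner_apply, conj_trivial, mul_comm]
  · intro k e
    have h := B.sum_repr ⟨r' k, hr k⟩
    have h2 := congrArg (fun v : V => (v : EuclideanSpace ℝ ι) e) h
    simp only [Submodule.coe_sum, Submodule.coe_smul, WithLp.ofLp_sum, WithLp.ofLp_smul,
      Finset.sum_apply, Pi.smul_apply, smul_eq_mul] at h2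
    exact h2.symm

/-- The mass of an orthonormal family on a set of coordinates. -/
def coordMass {ι : Type*} {d : ℕ} (b : Fin d → ι → ℝ) (W : Finset ι) : ℝ :=
  ∑ e ∈ W, ∑ i, b i e ^ 2

theorem coordMass_nonneg {ι : Type*} {d : ℕ} (b : Fin d → ι → ℝ) (W : Finset ι) :
    0 ≤ coordMass b W :=
  Finset.sum_nonneg fun _ _ => Finset.sum_nonneg fun _ _ => sq_nonneg _

/-- The `d` unit vectors have total mass `d`, and each coordinate is counted at most `m` times. -/
theorem sum_coordMass_le {ι κ : Type*} [Fintype ι] [DecidableEq ι] [Fintype κ] {d : ℕ}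
    (b : Fin d → ι → ℝ)
    (hb : ∀ i j, ∑ e, b i e * b j e = if i = j then 1 else 0) (W : κ → Finset ι) (m : ℕ)
    (hW : ∀ e, (Finset.univ.filter fun k => e ∈ W k).card ≤ m) :
    ∑ k, coordMass b (W k) ≤ m * d := by
  have h1 : ∀ k, coordMass b (W k) = ∑ e, if e ∈ W k then ∑ i, b i e ^ 2 else 0 := by
    intro k; simp [coordMass]
  simp_rw [h1]
  rw [Finset.sum_comm]
  calc _ ≤ ∑ e, (m : ℝ) * ∑ i, b i e ^ 2 := by
        refine Finset.sum_le_sum fun e _ => ?_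
        rw [← Finset.sum_filter, Finset.sum_const, nsmul_eq_mul]
        refine mul_le_mul_of_nonneg_right ?_ (Finset.sum_nonneg fun _ _ => sq_nonneg _)
        exact_mod_cast hW e
    _ = m * d := by
        rw [← Finset.mul_sum, Finset.sum_comm]
        congr 1
        have : ∀ i, ∑ e, b i e ^ 2 = 1 := fun i => by simpa [pow_two] using hb i i
        simp [this]

/-- If an orthonormal family has little mass on `W`, its values on any vector can be matched by a
short vector supported off `W`. -/
theorem exists_matching_vector {ι : Type*} [Fintype ι] [DecidableEq ι] {d : ℕ}
    (b : Fin d → ι → ℝ)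
    (hb : ∀ i j, ∑ e, b i e * b j e = if i = j then 1 else 0) (W : Finset ι)
    (hW : coordMass b W ≤ 1 / 2) (β : Fin d → ℝ) :
    ∃ u : ι → ℝ, (∀ e ∈ W, u e = 0) ∧ (∀ i, ∑ e, b i e * u e = β i) ∧
      ∑ e, u e ^ 2 ≤ 2 * ∑ i, β i ^ 2 := by
  -- `U y` is the combination `∑ y i * b i` truncated off `W`, and `S` is the Gram operator of the
  -- truncated family. Truncation loses at most half of the squared norm, so `S` is positive
  -- definite and `S y = β` is solvable.
  let U : (Fin d → ℝ) → ι → ℝ := fun y e => if e ∈ W then 0 else ∑ i, y i * b i e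
  let S : (Fin d → ℝ) →ₗ[ℝ] (Fin d → ℝ) :=
    { toFun := fun y j => ∑ e, b j e * U y e
      map_add' := by
        intro x y; ext j
        simp only [U, Pi.add_apply, ← Finset.sum_add_distrib]
        refine Finset.sum_congr rfl fun e _ => ?_
        split_ifs
        · simp
        · simp only [add_mul, Finset.sum_add_distrib, mul_add]
      map_smul' := by
        intro c y; ext j
        simp only [U, Pi.smul_apply, smul_eq_mul, RingHom.id_apply, Finset.mul_sum]
        refine Finset.sum_congr rfl fun e _ => ?_
        split_ifs
        · simp
        · simp only [Finset.mul_sum]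
          refine Finset.sum_congr rfl fun i _ => by ring }
  have hSy : ∀ y, ∑ j, y j * S y j = ∑ e, U y e ^ 2 := by
    intro y
    simp only [S, LinearMap.coe_mk, AddHom.coe_mk, Finset.mul_sum]
    rw [Finset.sum_comm]
    refine Finset.sum_congr rfl fun e _ => ?_
    simp only [← mul_assoc, ← Finset.sum_mul]
    simp only [U]
    split_ifs
    · simp
    · ring
  have hfull : ∀ y : Fin d → ℝ, ∑ e, (∑ i, y i * b i e) ^ 2 = ∑ i, y i ^ 2 := by
    intro y
    calc ∑ e, (∑ i, y i * b i e) ^ 2 = ∑ e, ∑ i, ∑ j, y i * y j * (b i e * b j e) := by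
          refine Finset.sum_congr rfl fun e _ => ?_
          rw [pow_two, Finset.sum_mul_sum]
          exact Finset.sum_congr rfl fun i _ => Finset.sum_congr rfl fun j _ => by ring
      _ = ∑ i, ∑ j, y i * y j * ∑ e, b i e * b j e := by
          rw [Finset.sum_comm]
          refine Finset.sum_congr rfl fun i _ => ?_
          rw [Finset.sum_comm]
          exact Finset.sum_congr rfl fun j _ => by rw [Finset.mul_sum]
      _ = ∑ i, y i ^ 2 := by simp [hb, pow_two]
  have hlow : ∀ y : Fin d → ℝ, 1 / 2 * ∑ i, y i ^ 2 ≤ ∑ e, U y e ^ 2 := by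
    intro y
    have h1 : ∑ e, U y e ^ 2 + ∑ e ∈ W, (∑ i, y i * b i e) ^ 2 = ∑ i, y i ^ 2 := by
      rw [← hfull y, ← Finset.sum_add_sum_compl W (fun e => U y e ^ 2),
        ← Finset.sum_add_sum_compl W (fun e => (∑ i, y i * b i e) ^ 2)]
      have a1 : ∑ e ∈ W, U y e ^ 2 = 0 :=
        Finset.sum_eq_zero fun e he => by simp [U, he]
      have a2 : ∑ e ∈ Wᶜ, U y e ^ 2 = ∑ e ∈ Wᶜ, (∑ i, y i * b i e) ^ 2 :=
        Finset.sum_congr rfl fun e he => by simp [U, Finset.mem_compl.1 he]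
      rw [a1, a2]; ring
    have h2 : ∑ e ∈ W, (∑ i, y i * b i e) ^ 2 ≤ coordMass b W * ∑ i, y i ^ 2 := by
      rw [coordMass, Finset.sum_mul]
      refine Finset.sum_le_sum fun e _ => ?_
      rw [mul_comm]
      exact Finset.sum_mul_sq_le_sq_mul_sq _ _ _
    have h3 : 0 ≤ ∑ i, y i ^ 2 := Finset.sum_nonneg fun _ _ => sq_nonneg _
    nlinarith
  have hinj : Function.Injective S := by
    rw [injective_iff_map_eq_zero]
    intro y hy
    have h1 := hlow y
    rw [← hSy y, hy] at h1
    simp only [Pi.zero_apply, mul_zero, Finset.sum_const_zero] at h1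
    have h2 : ∑ i, y i ^ 2 = 0 :=
      le_antisymm (by linarith) (Finset.sum_nonneg fun _ _ => sq_nonneg _)
    ext i
    exact pow_eq_zero_iff two_ne_zero |>.1
      ((Finset.sum_eq_zero_iff_of_nonneg fun _ _ => sq_nonneg _).1 h2 i (Finset.mem_univ i))
  obtain ⟨y, hy⟩ := LinearMap.injective_iff_surjective.1 hinj β
  refine ⟨U y, fun e he => by simp [U, he], fun i => congrFun hy i, ?_⟩
  have h1 := hlow y
  have h2 := hSy y
  rw [hy] at h2
  -- With `S y = β`, both `‖U y‖² = ⟨y, β⟩` and `‖y‖² ≤ 2⟨y, β⟩` hold. Expanding `‖y - 2β‖² ≥ 0`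
  -- then gives `⟨y, β⟩ ≤ 2‖β‖²`.
  have h3 : 0 ≤ ∑ j, (y j - 2 * β j) ^ 2 := Finset.sum_nonneg fun _ _ => sq_nonneg _
  have h4 : ∑ j, (y j - 2 * β j) ^ 2 =
      ∑ j, y j ^ 2 - 4 * ∑ j, y j * β j + 4 * ∑ j, β j ^ 2 := by
    rw [Finset.mul_sum, Finset.mul_sum, ← Finset.sum_sub_distrib, ← Finset.sum_add_distrib]
    exact Finset.sum_congr rfl fun j _ => by ring
  linarith

/-! ### Moments under product measures -/

theorem sum_mul_update {ι : Type*} [DecidableEq ι] {s : Finset ι} {B : ι → (ι → ℝ) → ℝ} {a : ι}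
    (ha : a ∉ s)
    (hB : ∀ k ∈ s, ∀ x t, B k (Function.update x a t) = B k x) (x : ι → ℝ) (t : ℝ) :
    ∑ k ∈ s, Function.update x a t k * B k (Function.update x a t) = ∑ k ∈ s, x k * B k x := by
  refine Finset.sum_congr rfl fun k hk => ?_
  rw [hB k hk, Function.update_of_ne (ne_of_mem_of_not_mem hk ha)]

section ProductMoments

variable {ι : Type*} [Fintype ι] [DecidableEq ι] (μ : ι → Measure ℝ)
  [∀ i, IsProbabilityMeasure (μ i)]

/-- Choosing the coordinates in `W` and off `W` from independent samples. -/
theorem measurePreserving_piecewise (W : Finset ι) :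
    MeasurePreserving (fun p : (ι → ℝ) × (ι → ℝ) => W.piecewise p.1 p.2)
      ((Measure.pi μ).prod (Measure.pi μ)) (Measure.pi μ) := by
  have hm : Measurable fun p : (ι → ℝ) × (ι → ℝ) => W.piecewise p.1 p.2 := by
    refine measurable_pi_iff.2 fun i => ?_
    by_cases hi : i ∈ W
    · simp only [Finset.piecewise_eq_of_mem _ _ _ hi]; fun_prop
    · simp only [Finset.piecewise_eq_of_notMem _ _ _ hi]; fun_prop
  refine ⟨hm, (Measure.pi_eq fun s hs => ?_).symm⟩
  rw [Measure.map_apply hm (MeasurableSet.univ_pi hs)]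
  have : (fun p : (ι → ℝ) × (ι → ℝ) => W.piecewise p.1 p.2) ⁻¹' Set.univ.pi s =
      (Set.univ.pi fun i => if i ∈ W then s i else Set.univ) ×ˢ
        (Set.univ.pi fun i => if i ∈ W then Set.univ else s i) := by
    ext p
    simp only [Set.mem_preimage, Set.mem_pi, Set.mem_univ, forall_const, Set.mem_prod,
      ← forall_and]
    refine forall_congr' fun i => ?_
    by_cases hi : i ∈ W <;> simp [hi]
  rw [this, Measure.prod_prod, Measure.pi_pi, Measure.pi_pi, ← Finset.prod_mul_distrib]
  refine Finset.prod_congr rfl fun i _ => ?_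
  by_cases hi : i ∈ W <;> simp [hi]

/-- Resampling one coordinate. -/
theorem measurePreserving_update (k : ι) :
    MeasurePreserving (fun p : (ι → ℝ) × ℝ => Function.update p.1 k p.2)
      ((Measure.pi μ).prod (μ k)) (Measure.pi μ) := by
  have hm : Measurable fun p : (ι → ℝ) × ℝ => Function.update p.1 k p.2 := by
    refine measurable_pi_iff.2 fun i => ?_
    by_cases hi : i = k
    · subst hi; simpa only [Function.update_self] using measurable_snd
    · simp only [Function.update_of_ne hi]; fun_prop
  refine ⟨hm, (Measure.pi_eq fun s hs => ?_).symm⟩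
  rw [Measure.map_apply hm (MeasurableSet.univ_pi hs)]
  have : (fun p : (ι → ℝ) × ℝ => Function.update p.1 k p.2) ⁻¹' Set.univ.pi s =
      (Set.univ.pi (Function.update s k Set.univ)) ×ˢ s k := by
    ext p
    simp only [Set.mem_preimage, Set.mem_pi, Set.mem_univ, forall_const, Set.mem_prod]
    constructor
    · refine fun h => ⟨fun i => ?_, by simpa using h k⟩
      by_cases hi : i = k
      · subst hi; simp
      · simpa [hi] using h i
    · rintro ⟨h, hk⟩ i
      by_cases hi : i = k
      · subst hi; simpa using hk
      · simpa [hi] using h i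
  rw [this, Measure.prod_prod, Measure.pi_pi,
    ← Finset.mul_prod_erase _ _ (Finset.mem_univ k), ← Finset.mul_prod_erase _ _ (Finset.mem_univ k),
    Function.update_self, measure_univ, one_mul, mul_comm]
  congr 1
  refine Finset.prod_congr rfl fun i hi => ?_
  rw [Function.update_of_ne (Finset.ne_of_mem_erase hi)]

variable {μ}

/-- Resampling coordinate `k` preserves the law, and `G` does not see the new value, so Fubini
separates the factors. Independence is phrased as invariance under `Function.update`, which avoids
splitting the product space. -/
theorem integral_eval_mul {k : ι} {f : ℝ → ℝ} {G : (ι → ℝ) → ℝ} (hf : Measurable f)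
    (hG : Measurable G) (h : ∀ x t, G (Function.update x k t) = G x) :
    ∫ x, f (x k) * G x ∂Measure.pi μ = (∫ t, f t ∂μ k) * ∫ x, G x ∂Measure.pi μ := by
  have hm := measurePreserving_update μ k
  have hF : Measurable fun x : ι → ℝ => f (x k) * G x := by fun_prop
  rw [← hm.map_eq, integral_map hm.measurable.aemeasurable hF.aestronglyMeasurable, hm.map_eq]
  simp only [Function.update_self, h]
  rw [mul_comm, ← integral_prod_mul]
  simp only [mul_comm]

theorem integrable_eval_mul {k : ι} {f : ℝ → ℝ} {G : (ι → ℝ) → ℝ} (hf : Measurable f)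
    (hG : Measurable G) (h : ∀ x t, G (Function.update x k t) = G x)
    (hfi : Integrable f (μ k)) (hGi : Integrable G (Measure.pi μ)) :
    Integrable (fun x => f (x k) * G x) (Measure.pi μ) := by
  have hm := measurePreserving_update μ k
  have hF : Measurable fun x : ι → ℝ => f (x k) * G x := by fun_prop
  rw [← hm.integrable_comp hF.aestronglyMeasurable]
  refine (hGi.mul_prod hfi).congr (.of_forall fun p => ?_)
  simp [h, mul_comm]

theorem abs_pow_mul_pow_le {n i j : ℕ} (hij : i + j = n) (hn : Even n) (x y : ℝ) :
    |x ^ i * y ^ j| ≤ x ^ n + y ^ n := by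
  rw [abs_mul, abs_pow, abs_pow, ← hn.pow_abs x, ← hn.pow_abs y, ← hij]
  have hx := abs_nonneg x
  have hy := abs_nonneg y
  rcases le_total |x| |y| with h | h
  · calc |x| ^ i * |y| ^ j ≤ |y| ^ i * |y| ^ j := by gcongr
      _ ≤ _ := by rw [← pow_add]; linarith [pow_nonneg hx (i + j)]
  · calc |x| ^ i * |y| ^ j ≤ |x| ^ i * |x| ^ j := by gcongr
      _ ≤ _ := by rw [← pow_add]; linarith [pow_nonneg hy (i + j)]

theorem integrable_pow_mul_pow {α : Type*} [MeasurableSpace α] {P : Measure α} {n i j : ℕ}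
    (hij : i + j = n) (hn : Even n) {f g : α → ℝ} (hf : Measurable f) (hg : Measurable g)
    (hfi : Integrable (fun x => f x ^ n) P) (hgi : Integrable (fun x => g x ^ n) P) :
    Integrable (fun x => f x ^ i * g x ^ j) P := by
  refine (hfi.add hgi).mono' (by fun_prop) (.of_forall fun x => ?_)
  exact abs_pow_mul_pow_le hij hn _ _

theorem integrable_pow_of_le {P : Measure ℝ} [IsProbabilityMeasure P] {n i : ℕ} (hi : i ≤ n)
    (hn : Even n) (h : Integrable (fun x : ℝ => x ^ n) P) : Integrable (fun x : ℝ => x ^ i) P := by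
  have := integrable_pow_mul_pow (P := P) (Nat.add_sub_cancel' hi) hn measurable_id
    (measurable_const (a := (1 : ℝ))) h (by simp)
  simpa using this

/-- Orthogonality: the second moment of `∑ x_k B_k`, where the `B_k` do not depend on the
coordinates over which the sum extends. -/
theorem integral_sum_mul_sq {v : ℝ} (h1 : ∀ i, ∫ x, x ∂μ i = 0) (h2 : ∀ i, ∫ x, x ^ 2 ∂μ i = v)
    (hi : ∀ i, Integrable (fun x : ℝ => x ^ 2) (μ i)) (s : Finset ι) (B : ι → (ι → ℝ) → ℝ)
    (hBm : ∀ k, Measurable (B k)) (hBi : ∀ k ∈ s, Integrable (fun x => B k x ^ 2) (Measure.pi μ))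
    (hBu : ∀ k ∈ s, ∀ j ∈ s, ∀ x t, B k (Function.update x j t) = B k x) :
    Integrable (fun x => (∑ k ∈ s, x k * B k x) ^ 2) (Measure.pi μ) ∧
      ∫ x, (∑ k ∈ s, x k * B k x) ^ 2 ∂Measure.pi μ =
        v * ∑ k ∈ s, ∫ x, B k x ^ 2 ∂Measure.pi μ := by
  induction s using Finset.induction_on with
  | empty => simp
  | insert a s ha ih =>
    obtain ⟨hI, hE⟩ := ih (fun k hk => hBi k (Finset.mem_insert_of_mem hk))
      fun k hk j hj => hBu k (Finset.mem_insert_of_mem hk) j (Finset.mem_insert_of_mem hj)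
    set G : (ι → ℝ) → ℝ := fun x => ∑ k ∈ s, x k * B k x with hG
    have hGm : Measurable G := by fun_prop
    have hGu : ∀ x t, G (Function.update x a t) = G x := sum_mul_update ha fun k hk =>
      hBu k (Finset.mem_insert_of_mem hk) a (Finset.mem_insert_self a s)
    have hBa := hBu a (Finset.mem_insert_self a s) a (Finset.mem_insert_self a s)
    have hBai := hBi a (Finset.mem_insert_self a s)
    have hBam := hBm a
    have iGB : Integrable (fun x => G x * B a x) (Measure.pi μ) := by
      simpa using integrable_pow_mul_pow (i := 1) (j := 1) rfl even_two hGm hBam hI hBai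
    have i1 : Integrable (fun x => x a * (G x * B a x)) (Measure.pi μ) :=
      integrable_eval_mul (f := fun t => t) measurable_id (by fun_prop) (fun x t => by rw [hGu, hBa])
        (by simpa using integrable_pow_of_le one_le_two even_two (hi a)) iGB
    have i2 : Integrable (fun x => x a ^ 2 * B a x ^ 2) (Measure.pi μ) :=
      integrable_eval_mul (f := fun t => t ^ 2) (by fun_prop) (by fun_prop)
        (fun x t => by rw [hBa]) (hi a) hBai
    have e1 : ∫ x, x a * (G x * B a x) ∂Measure.pi μ = 0 := by
      rw [integral_eval_mul (f := fun t => t) measurable_id (by fun_prop)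
        (fun x t => by rw [hGu, hBa]), h1, zero_mul]
    have e2 : ∫ x, x a ^ 2 * B a x ^ 2 ∂Measure.pi μ = v * ∫ x, B a x ^ 2 ∂Measure.pi μ := by
      rw [integral_eval_mul (f := fun t => t ^ 2) (by fun_prop) (by fun_prop)
        (fun x t => by rw [hBa]), h2]
    have i3 : Integrable (fun x => x a ^ 2 * B a x ^ 2 + 2 * (x a * (G x * B a x)))
      (Measure.pi μ) := i2.add (i1.const_mul 2)
    have i4 : Integrable (fun x => x a ^ 2 * B a x ^ 2 + 2 * (x a * (G x * B a x)) + G x ^ 2)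
      (Measure.pi μ) := i3.add hI
    have e : ∀ x : ι → ℝ, (∑ k ∈ insert a s, x k * B k x) ^ 2 =
        x a ^ 2 * B a x ^ 2 + 2 * (x a * (G x * B a x)) + G x ^ 2 := by
      intro x; rw [Finset.sum_insert ha, hG]; ring
    simp_rw [e]
    refine ⟨i4, ?_⟩
    rw [integral_add i3 hI, integral_add i2 (i1.const_mul 2), integral_const_mul, e1, e2, hE,
      Finset.sum_insert ha]
    ring

end ProductMoments

/-- The constant in the fourth moment bound for multilinear forms of degree one more. -/
def fourthMomentConst (M : ℝ) : ℝ := (3 + M) ^ 2 + 3 * M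

/-- The fourth moment of `∑ x_k B_k`, where `B_k` depends only on the coordinates before `k`. -/
theorem integral_sum_mul_pow_four_le {n : ℕ} {μ : Fin n → Measure ℝ}
    [∀ i, IsProbabilityMeasure (μ i)] {M b : ℝ} (hM : 0 ≤ M) (hb : 0 ≤ b)
    (hi : ∀ i, Integrable (fun x : ℝ => x ^ 4) (μ i))
    (h1 : ∀ i, ∫ x, x ∂μ i = 0) (h2 : ∀ i, ∫ x, x ^ 2 ∂μ i = 1)
    (h3 : ∀ i, |∫ x, x ^ 3 ∂μ i| ≤ M) (h4 : ∀ i, ∫ x, x ^ 4 ∂μ i ≤ M)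
    (s : Finset (Fin n)) (B : Fin n → (Fin n → ℝ) → ℝ) (hBm : ∀ k, Measurable (B k))
    (hBi : ∀ k, Integrable (fun x => B k x ^ 4) (Measure.pi μ))
    (hBb : ∀ k, ∫ x, B k x ^ 4 ∂Measure.pi μ ≤ b)
    (hBu : ∀ k j, k ≤ j → ∀ x t, B k (Function.update x j t) = B k x) :
    Integrable (fun x => (∑ k ∈ s, x k * B k x) ^ 4) (Measure.pi μ) ∧
      ∫ x, (∑ k ∈ s, x k * B k x) ^ 4 ∂Measure.pi μ ≤
        fourthMomentConst M * b * (s.card : ℝ) ^ 2 := by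
  -- Adding the largest index last ensures that neither the earlier sum `G` nor `B a` depends on `x
  -- a`. The expansion then factors by powers of `x a`, and the first-order term vanishes.
  induction s using Finset.induction_on_max with
  | empty => simp
  | insert a s has ih =>
    obtain ⟨hI, hE⟩ := ih
    have ha : a ∉ s := fun h => lt_irrefl a (has a h)
    set G : (Fin n → ℝ) → ℝ := fun x => ∑ k ∈ s, x k * B k x with hG
    have hGm : Measurable G := by fun_prop
    have hGu : ∀ x t, G (Function.update x a t) = G x := sum_mul_update ha fun k hk =>
      hBu k a (has k hk).le
    have hBa := hBu a a le_rfl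
    have hBam := hBm a
    have ev : Even 4 := by decide
    have hmix : ∀ i j : ℕ, i + j = 4 →
        Integrable (fun x => G x ^ i * B a x ^ j) (Measure.pi μ) := fun i j hij =>
      integrable_pow_mul_pow hij ev hGm hBam hI (hBi a)
    have hint : ∀ p i j : ℕ, p ≤ 4 → i + j = 4 →
        Integrable (fun x => x a ^ p * (G x ^ i * B a x ^ j)) (Measure.pi μ) := fun p i j hp hij =>
      integrable_eval_mul (f := fun t => t ^ p) (by fun_prop) (by fun_prop)
        (fun x t => by rw [hGu, hBa]) (integrable_pow_of_le hp ev (hi a)) (hmix i j hij)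
    have heval : ∀ p i j : ℕ, ∫ x, x a ^ p * (G x ^ i * B a x ^ j) ∂Measure.pi μ =
        (∫ t, t ^ p ∂μ a) * ∫ x, G x ^ i * B a x ^ j ∂Measure.pi μ := fun p i j =>
      integral_eval_mul (f := fun t => t ^ p) (by fun_prop) (by fun_prop)
        (fun x t => by rw [hGu, hBa])
    have e : ∀ x : Fin n → ℝ, (∑ k ∈ insert a s, x k * B k x) ^ 4 =
        G x ^ 4 + (4 * (x a ^ 1 * (G x ^ 3 * B a x ^ 1)) + (6 * (x a ^ 2 * (G x ^ 2 * B a x ^ 2)) +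
          (4 * (x a ^ 3 * (G x ^ 1 * B a x ^ 3)) + x a ^ 4 * (G x ^ 0 * B a x ^ 4)))) := by
      intro x; rw [Finset.sum_insert ha, hG]; ring
    have i1 := (hint 1 3 1 (by norm_num) rfl).const_mul 4
    have i2 := (hint 2 2 2 (by norm_num) rfl).const_mul 6
    have i3 := (hint 3 1 3 (by norm_num) rfl).const_mul 4
    have i4 := hint 4 0 4 (by norm_num) rfl
    simp_rw [e]
    replace hI : Integrable (fun x => G x ^ 4) (Measure.pi μ) := hI
    have i34 : Integrable (fun x => 4 * (x a ^ 3 * (G x ^ 1 * B a x ^ 3)) +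
      x a ^ 4 * (G x ^ 0 * B a x ^ 4)) (Measure.pi μ) := i3.add i4
    have i234 : Integrable (fun x => 6 * (x a ^ 2 * (G x ^ 2 * B a x ^ 2)) +
      (4 * (x a ^ 3 * (G x ^ 1 * B a x ^ 3)) + x a ^ 4 * (G x ^ 0 * B a x ^ 4)))
      (Measure.pi μ) := i2.add i34
    have i1234 : Integrable (fun x => 4 * (x a ^ 1 * (G x ^ 3 * B a x ^ 1)) +
      (6 * (x a ^ 2 * (G x ^ 2 * B a x ^ 2)) + (4 * (x a ^ 3 * (G x ^ 1 * B a x ^ 3)) +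
        x a ^ 4 * (G x ^ 0 * B a x ^ 4)))) (Measure.pi μ) := i1.add i234
    refine ⟨hI.add i1234, ?_⟩
    rw [integral_add hI i1234, integral_add i1 i234, integral_add i2 i34, integral_add i3 i4,
      integral_const_mul, integral_const_mul, integral_const_mul, heval, heval, heval, heval]
    simp only [pow_one, pow_zero, one_mul]
    rw [h1, h2, zero_mul, mul_zero, zero_add, one_mul, Finset.card_insert_of_notMem ha]
    have hq := hBb a
    set f := ∫ x, G x ^ 4 ∂Measure.pi μ
    set Q := ∫ x, G x ^ 2 * B a x ^ 2 ∂Measure.pi μ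
    set R := ∫ x, G x * B a x ^ 3 ∂Measure.pi μ
    set T := ∫ x, B a x ^ 4 ∂Measure.pi μ
    have hT : 0 ≤ T := integral_nonneg fun x => by positivity
    have hQ : 0 ≤ Q := integral_nonneg fun x => by positivity
    have hR : |R| ≤ 1 / 2 * (Q + T) := by
      have hsum : Integrable (fun x => 1 / 2 * (G x ^ 2 * B a x ^ 2 + B a x ^ 4))
        (Measure.pi μ) := ((hmix 2 2 rfl).add (hBi a)).const_mul _
      calc |R| ≤ ∫ x, |G x * B a x ^ 3| ∂Measure.pi μ := abs_integral_le_integral_abs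
        _ ≤ ∫ x, 1 / 2 * (G x ^ 2 * B a x ^ 2 + B a x ^ 4) ∂Measure.pi μ := by
            refine integral_mono_of_nonneg (.of_forall fun x => abs_nonneg _) hsum
              (.of_forall fun x => ?_)
            refine abs_le.2 ⟨?_, ?_⟩ <;>
            nlinarith [mul_nonneg (sq_nonneg (B a x)) (sq_nonneg (G x + B a x)),
              mul_nonneg (sq_nonneg (B a x)) (sq_nonneg (G x - B a x))]
        _ = _ := by rw [integral_const_mul, integral_add (hmix 2 2 rfl) (hBi a)]
    have hQl : ∀ l : ℝ, 0 < l → 2 * Q ≤ l * f + l⁻¹ * T := by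
      intro l hl
      have hsum : Integrable (fun x => l * G x ^ 4 + l⁻¹ * B a x ^ 4) (Measure.pi μ) :=
        (hI.const_mul l).add ((hBi a).const_mul _)
      rw [← integral_const_mul, ← integral_const_mul l, ← integral_const_mul l⁻¹,
        ← integral_add (hI.const_mul l) ((hBi a).const_mul _)]
      refine integral_mono ((hmix 2 2 rfl).const_mul 2) hsum fun x => ?_
      have : l * G x ^ 4 + l⁻¹ * B a x ^ 4 - 2 * (G x ^ 2 * B a x ^ 2) =
          l⁻¹ * (l * G x ^ 2 - B a x ^ 2) ^ 2 := by field_simp; ring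
      have h0 : 0 ≤ l⁻¹ * (l * G x ^ 2 - B a x ^ 2) ^ 2 := by positivity
      simp only
      linarith
    have hm3 : 4 * ((∫ x, x ^ 3 ∂μ a) * R) ≤ 2 * M * (Q + T) := by
      have : (∫ x, x ^ 3 ∂μ a) * R ≤ M * (1 / 2 * (Q + T)) := by
        refine (le_abs_self _).trans ?_
        rw [abs_mul]
        exact mul_le_mul (h3 a) hR (abs_nonneg _) hM
      linarith
    have hm4 : (∫ x, x ^ 4 ∂μ a) * T ≤ M * T := mul_le_mul_of_nonneg_right (h4 a) hT
    have hmp : (0 : ℝ) < (s.card : ℝ) + 1 := by positivity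
    set m : ℝ := (s.card : ℝ) with hmdef
    have hm0 : 0 ≤ m := Nat.cast_nonneg _
    have hA : 0 < 3 + M := by linarith
    have hQ' : 2 * (3 + M) * Q ≤ f / (m + 1) + (3 + M) ^ 2 * (m + 1) * T := by
      -- This weight leaves `f` with the coefficient `1 / (m + 1)`. Since `m² (1 + 1/(m+1)) ≤ m² +
      -- m`, the growth from `m²` to `(m+1)²` has room `m + 1` left for the terms with `T`.
      have := hQl (1 / ((3 + M) * (m + 1))) (by positivity)
      calc 2 * (3 + M) * Q = (3 + M) * (2 * Q) := by ring
        _ ≤ (3 + M) * (1 / ((3 + M) * (m + 1)) * f + (1 / ((3 + M) * (m + 1)))⁻¹ * T) := by gcongr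
        _ = _ := by field_simp
    have hf0 : 0 ≤ f := integral_nonneg fun x => by positivity
    have hfm : f + f / (m + 1) ≤ fourthMomentConst M * b * (m ^ 2 + m) := by
      have hK : 0 ≤ fourthMomentConst M * b := by unfold fourthMomentConst; positivity
      calc f + f / (m + 1) = f * (1 + 1 / (m + 1)) := by ring
        _ ≤ fourthMomentConst M * b * m ^ 2 * (1 + 1 / (m + 1)) := by gcongr
        _ = fourthMomentConst M * b * (m ^ 2 * (1 + 1 / (m + 1))) := by ring
        _ ≤ _ := by
            refine mul_le_mul_of_nonneg_left ?_ hK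
            rw [mul_add, mul_one, mul_one_div]
            gcongr
            rw [div_le_iff₀ hmp]; nlinarith
    push_cast
    have hTb1 : (3 + M) ^ 2 * (m + 1) * T ≤ (3 + M) ^ 2 * (m + 1) * b := by gcongr
    have hTb2 : 3 * M * T ≤ 3 * M * b * (m + 1) := by
      calc 3 * M * T ≤ 3 * M * b := by gcongr
        _ ≤ 3 * M * b * (m + 1) := le_mul_of_one_le_right (by positivity) (by linarith)
    have : fourthMomentConst M * b * (m + 1) ^ 2 = fourthMomentConst M * b * (m ^ 2 + m) +
        ((3 + M) ^ 2 * (m + 1) * b + 3 * M * b * (m + 1)) := by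
      unfold fourthMomentConst; ring
    rw [this]
    linarith

/-! ### Erasures are hard to detect by few linear measurements -/

section RealSections

variable {α β : Type*} [MeasurableSpace α] [MeasurableSpace β] (μ : Measure α) (ν : Measure β)
  [IsProbabilityMeasure ν]

theorem real_prod_eq_integral_left {S : Set (α × β)} (hS : MeasurableSet S) :
    (μ.prod ν).real S = ∫ x, ν.real (Prod.mk x ⁻¹' S) ∂μ := by
  rw [measureReal_def, Measure.prod_apply hS]
  exact (integral_toReal (measurable_measure_prodMk_left hS).aemeasurable
    (.of_forall fun x => measure_lt_top _ _)).symm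

theorem real_prod_eq_integral_right [IsProbabilityMeasure μ] {S : Set (α × β)} (hS : MeasurableSet S) :
    (μ.prod ν).real S = ∫ y, μ.real ((fun x => (x, y)) ⁻¹' S) ∂ν := by
  rw [measureReal_def, Measure.prod_apply_symm hS]
  exact (integral_toReal (measurable_measure_prodMk_right hS).aemeasurable
    (.of_forall fun x => measure_lt_top _ _)).symm

theorem integrable_real_section_left [IsProbabilityMeasure μ] {S : Set (α × β)} (hS : MeasurableSet S) :
    Integrable (fun x => ν.real (Prod.mk x ⁻¹' S)) μ := by
  refine Integrable.of_bound (C := 1)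
    (measurable_measure_prodMk_left hS).ennreal_toReal.aestronglyMeasurable
    (.of_forall fun x => ?_)
  rw [Real.norm_of_nonneg measureReal_nonneg]
  exact measureReal_le_one

theorem integrable_real_section_right [IsProbabilityMeasure μ] {S : Set (α × β)} (hS : MeasurableSet S) :
    Integrable (fun y => μ.real ((fun x => (x, y)) ⁻¹' S)) ν := by
  refine Integrable.of_bound (C := 1)
    (measurable_measure_prodMk_right hS).ennreal_toReal.aestronglyMeasurable
    (.of_forall fun x => ?_)
  rw [Real.norm_of_nonneg measureReal_nonneg]
  exact measureReal_le_one

end RealSections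

/-- Replace the coordinates in `W` by `0`. -/
def eraseOn {ι : Type*} [DecidableEq ι] (W : Finset ι) (a : ι → ℝ) : ι → ℝ :=
  fun e => if e ∈ W then 0 else a e

theorem measurable_eraseOn {ι : Type*} [DecidableEq ι] (W : Finset ι) :
    Measurable (eraseOn W) := by
  refine measurable_pi_iff.2 fun e => ?_
  by_cases he : e ∈ W
  · simp [eraseOn, he]
  · simpa [eraseOn, he] using measurable_pi_apply e

namespace IsProfile

variable {φ : ℝ → ℝ} {C : ℝ}

theorem integrable_sq_sqDensity (h : IsProfile φ C) :
    Integrable (fun t : ℝ => t ^ 2) (sqDensity φ) := by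
  have := h.isProbabilityMeasure
  refine Integrable.of_bound (C := 4) (by fun_prop) ?_
  filter_upwards [h.ae_abs_mem] with t ht
  rw [Real.norm_of_nonneg (sq_nonneg t), ← sq_abs]
  nlinarith [abs_nonneg t]

theorem integral_sq_sqDensity_le (h : IsProfile φ C) : ∫ t, t ^ 2 ∂sqDensity φ ≤ 4 := by
  have := h.isProbabilityMeasure
  calc ∫ t, t ^ 2 ∂sqDensity φ ≤ ∫ _, (4 : ℝ) ∂sqDensity φ := by
        refine integral_mono_ae h.integrable_sq_sqDensity (integrable_const _) ?_
        filter_upwards [h.ae_abs_mem] with t ht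
        rw [← sq_abs]
        nlinarith [abs_nonneg t]
    _ = 4 := by simp

variable {ι : Type*} [Fintype ι] [DecidableEq ι]

/-- For linear measurements spanned by an orthonormal family with little mass on `W`, erasing the
coordinates in `W` is hard to detect. -/
theorem abs_real_sub_real_erase_le (h : IsProfile φ C) {d q : ℕ} (b : Fin d → ι → ℝ)
    (hb : ∀ i j, ∑ e, b i e * b j e = if i = j then 1 else 0) (r : Fin q → ι → ℝ)
    (g : Fin q → Fin d → ℝ) (hr : ∀ k e, r k e = ∑ i, g k i * b i e)
    {A : Set (Fin q → ℝ)} (hA : MeasurableSet A) (W : Finset ι) :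
    |(Measure.pi fun _ : ι => sqDensity φ).real {a | (fun k => ∑ e, r k e * a e) ∈ A} -
      (Measure.pi fun _ : ι => sqDensity φ).real
        {a | (fun k => ∑ e, r k e * eraseOn W a e) ∈ A}| ≤
      1 / 6 + (48 * C + 2) * coordMass b W := by
  have := h.isProbabilityMeasure
  set P := Measure.pi fun _ : ι => sqDensity φ with hP
  have hC := h.const_nonneg
  have ht0 := coordMass_nonneg b W
  -- For mass above `1/2` the bound is trivial: twice the mass already exceeds `1`. The summand `2`
  -- in the constant is there for this case.
  rcases le_or_gt (coordMass b W) (1 / 2) with ht | ht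
  swap
  · have h1 : P.real {a | (fun k => ∑ e, r k e * a e) ∈ A} ≤ 1 := measureReal_le_one
    have h2 : P.real {a | (fun k => ∑ e, r k e * eraseOn W a e) ∈ A} ≤ 1 := measureReal_le_one
    have h3 : 0 ≤ P.real {a | (fun k => ∑ e, r k e * a e) ∈ A} := measureReal_nonneg
    have h4 : 0 ≤ P.real {a | (fun k => ∑ e, r k e * eraseOn W a e) ∈ A} := measureReal_nonneg
    have h5 : 0 ≤ C * coordMass b W := mul_nonneg hC ht0
    exact abs_le.2 ⟨by nlinarith, by nlinarith⟩
  have hmeas : ∀ T : (ι → ℝ) → ι → ℝ, Measurable T →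
      Measurable fun a k => ∑ e, r k e * T a e := fun T hT => by fun_prop
  have hpw := measurePreserving_piecewise (fun _ : ι => sqDensity φ) W
  have hpw0 : Measurable fun a : ι → ℝ => eraseOn W a :=
    measurable_eraseOn W
  set D : Set (ι → ℝ) := {a | (fun k => ∑ e, r k e * eraseOn W a e) ∈ A} with hDdef
  have hD : MeasurableSet D := hmeas _ hpw0 hA
  set S : Set ((ι → ℝ) × (ι → ℝ)) := {p | (fun k => ∑ e, r k e * W.piecewise p.1 p.2 e) ∈ A}
    with hSdef
  have hfull : MeasurableSet {a : ι → ℝ | (fun k => ∑ e, r k e * a e) ∈ A} :=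
    hmeas _ measurable_id hA
  have hS : MeasurableSet S := hpw.measurable hfull
  -- `β w` is what the coordinates in `W` add to the measurements by `b`. For fixed `w`, a vector
  -- `u` supported off `W` with the same measurements turns the section of `S` at `w` into a
  -- translate of `D`.
  let β : (ι → ℝ) → Fin d → ℝ := fun w i => ∑ e ∈ W, w e * b i e
  have hsec : ∀ w, |P.real (Prod.mk w ⁻¹' S) - P.real D| ≤
      1 / 6 + 12 * C * ∑ i, β w i ^ 2 := by
    intro w
    obtain ⟨u, hu0, hu1, hu2⟩ := exists_matching_vector b hb W ht (β w)
    have hset : Prod.mk w ⁻¹' S = (· + u) ⁻¹' D := by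
      ext a
      simp only [hSdef, hDdef, Set.mem_preimage, Set.mem_ofPred_eq]
      have hk : ∀ i, ∑ e, b i e * W.piecewise w a e = ∑ e, b i e * eraseOn W (a + u) e := by
        intro i
        have e1 : ∀ e, b i e * eraseOn W (a + u) e =
            b i e * eraseOn W a e + b i e * u e := by
          intro e
          by_cases he : e ∈ W
          · simp [eraseOn, he, hu0 e he]
          · simp [eraseOn, he, mul_add]
        have e2 : ∀ e, b i e * W.piecewise w a e =
            b i e * eraseOn W a e + if e ∈ W then w e * b i e else 0 := by
          intro e
          by_cases he : e ∈ W
          · simp [eraseOn, he, mul_comm]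
          · simp [eraseOn, he]
        simp_rw [e1, e2, Finset.sum_add_distrib, hu1]
        simp [β]
      have : (fun k => ∑ e, r k e * W.piecewise w a e) =
          fun k => ∑ e, r k e * eraseOn W (a + u) e := by
        funext k
        simp_rw [hr, Finset.sum_mul]
        rw [Finset.sum_comm, Finset.sum_comm (s := Finset.univ (α := ι))]
        refine Finset.sum_congr rfl fun i _ => ?_
        simp_rw [mul_assoc, ← Finset.mul_sum, hk]
      rw [this]
    rw [hset]
    refine (h.abs_real_pi_translate_sub_le u hD).trans ?_
    nlinarith [mul_le_mul_of_nonneg_left hu2 hC]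
  have hmom : ∀ i, Integrable (fun w => β w i ^ 2) P ∧
      ∫ w, β w i ^ 2 ∂P = (∫ t, t ^ 2 ∂sqDensity φ) * ∑ e ∈ W, b i e ^ 2 := by
    intro i
    have := integral_sum_mul_sq (μ := fun _ : ι => sqDensity φ) (fun _ => h.integral_eq_zero)
      (fun _ => rfl) (fun _ => h.integrable_sq_sqDensity) W (fun e _ => b i e)
      (fun _ => measurable_const) (fun _ _ => integrable_const _) (fun _ _ _ _ _ _ => rfl)
    simpa using this
  have hint : Integrable (fun w => 1 / 6 + 12 * C * ∑ i, β w i ^ 2) P :=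
    (integrable_const _).add ((integrable_finsetSum _ fun i _ => (hmom i).1).const_mul _)
  have hfub : P.real {a | (fun k => ∑ e, r k e * a e) ∈ A} =
      ∫ w, P.real (Prod.mk w ⁻¹' S) ∂P := by
    rw [← real_prod_eq_integral_left P P hS, measureReal_def, measureReal_def,
      ← hpw.measure_preimage hfull.nullMeasurableSet]
    rfl
  have hdiff : P.real {a | (fun k => ∑ e, r k e * a e) ∈ A} - P.real D =
      ∫ w, (P.real (Prod.mk w ⁻¹' S) - P.real D) ∂P := by
    rw [integral_sub (integrable_real_section_left P P hS) (integrable_const _), hfub]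
    simp
  rw [hdiff]
  refine abs_integral_le_integral_abs.trans ?_
  calc ∫ w, |P.real (Prod.mk w ⁻¹' S) - P.real D| ∂P
      ≤ ∫ w, (1 / 6 + 12 * C * ∑ i, β w i ^ 2) ∂P :=
        integral_mono_of_nonneg (.of_forall fun w => abs_nonneg _) hint (.of_forall hsec)
    _ = 1 / 6 + 12 * C * ((∫ t, t ^ 2 ∂sqDensity φ) * coordMass b W) := by
        rw [integral_add (integrable_const _)
          ((integrable_finsetSum _ fun i _ => (hmom i).1).const_mul _), integral_const_mul,
          integral_finsetSum _ fun i _ => (hmom i).1]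
        simp_rw [fun i => (hmom i).2]
        rw [← Finset.mul_sum, coordMass, Finset.sum_comm]
        simp
    -- Here `48 = 12 * 4`, as the coefficients have second moment at most `4`.
    _ ≤ 1 / 6 + (48 * C + 2) * coordMass b W := by
        have hv := h.integral_sq_sqDensity_le
        have := mul_le_mul_of_nonneg_left (mul_le_mul_of_nonneg_right hv ht0) hC
        nlinarith

/-- Averaged over the sets `W k`, erasing the coordinates in `W k` is hard to detect by `q` linear
measurements. -/
theorem sum_real_erase_sub_real_le (h : IsProfile φ C) {κ : Type*} [Fintype κ] {q m : ℕ}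
    (W : κ → Finset ι) (hW : ∀ e, (Finset.univ.filter fun k => e ∈ W k).card ≤ m)
    (r : Fin q → ι → ℝ) {A : Set (Fin q → ℝ)} (hA : MeasurableSet A) :
    ∑ j, ((Measure.pi fun _ : ι => sqDensity φ).real
        {a | (fun k => ∑ e, r k e * eraseOn (W j) a e) ∈ A} -
      (Measure.pi fun _ : ι => sqDensity φ).real {a | (fun k => ∑ e, r k e * a e) ∈ A}) ≤
      Fintype.card κ / 6 + (48 * C + 2) * (m * q) := by
  obtain ⟨d, hd, b, g, hb, hr⟩ := exists_orthonormal_family_spanning r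
  have hC := h.const_nonneg
  calc _ ≤ ∑ j, (1 / 6 + (48 * C + 2) * coordMass b (W j)) := by
        refine Finset.sum_le_sum fun j _ => ?_
        refine (le_abs_self _).trans ?_
        rw [abs_sub_comm]
        exact h.abs_real_sub_real_erase_le b hb r g hr hA (W j)
    _ = Fintype.card κ / 6 + (48 * C + 2) * ∑ j, coordMass b (W j) := by
        rw [Finset.sum_add_distrib, ← Finset.mul_sum]
        simp [div_eq_mul_inv]
    _ ≤ _ := by
        have h1 := sum_coordMass_le b hb W m hW
        have h2 : (m : ℝ) * d ≤ m * q := by gcongr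
        gcongr
        exact h1.trans h2

/-- A randomized procedure that, from `q` linear measurements of `a`, distinguishes `a` from its
erasures on each of the sets `W k`, needs `q` at least of the order of the number of sets, if no
coordinate is in more than `m` of them. -/
theorem card_le_of_distinguishes (h : IsProfile φ C) {κ : Type*} [Fintype κ] {q m : ℕ}
    (W : κ → Finset ι) (hW : ∀ e, (Finset.univ.filter fun k => e ∈ W k).card ≤ m)
    {Ω : Type*} [MeasurableSpace Ω] (Pc : Measure Ω) [IsProbabilityMeasure Pc]
    (r : Ω → Fin q → ι → ℝ) (hr : ∀ k e, Measurable fun ω => r ω k e)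
    {acc : Set (Ω × (Fin q → ℝ))} (hacc : MeasurableSet acc)
    (hno : ∀ᵐ a ∂Measure.pi fun _ : ι => sqDensity φ,
      Pc.real {ω | (ω, fun k => ∑ e, r ω k e * a e) ∈ acc} ≤ 1 / 3)
    (hyes : ∀ᵐ a ∂Measure.pi fun _ : ι => sqDensity φ, ∀ j,
      2 / 3 ≤ Pc.real {ω | (ω, fun k => ∑ e, r ω k e * eraseOn (W j) a e) ∈ acc}) :
    (Fintype.card κ : ℝ) ≤ 6 * (48 * C + 2) * m * q := by
  have := h.isProbabilityMeasure
  set P := Measure.pi fun _ : ι => sqDensity φ with hP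
  have hmeas : ∀ T : (ι → ℝ) → ι → ℝ, Measurable T →
      MeasurableSet {p : Ω × (ι → ℝ) | (p.1, fun k => ∑ e, r p.1 k e * T p.2 e) ∈ acc} := by
    intro T hT
    have : Measurable fun p : Ω × (ι → ℝ) => (p.1, fun k => ∑ e, r p.1 k e * T p.2 e) := by
      refine measurable_fst.prodMk (measurable_pi_iff.2 fun k => ?_)
      refine Finset.measurable_sum _ fun e _ => ?_
      exact ((hr k e).comp measurable_fst).mul
        ((measurable_pi_apply e).comp (hT.comp measurable_snd))
    exact this hacc
  have hpw0 : ∀ j, Measurable fun a : ι → ℝ => eraseOn (W j) a := fun j =>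
    measurable_eraseOn (W j)
  have h0 := hmeas _ measurable_id
  have hj := fun j => hmeas _ (hpw0 j)
  -- Exchanging the averages allows the coins to be fixed first. The measurement vectors `r ω` are
  -- then deterministic, which is where non-adaptivity enters.
  have hswap : ∀ S : Set (Ω × (ι → ℝ)), MeasurableSet S →
      ∫ a, Pc.real ((fun ω => (ω, a)) ⁻¹' S) ∂P = ∫ ω, P.real (Prod.mk ω ⁻¹' S) ∂Pc :=
    fun S hS => by rw [← real_prod_eq_integral_right Pc P hS, real_prod_eq_integral_left Pc P hS]
  have hno' : ∫ ω, P.real {a | (ω, fun k => ∑ e, r ω k e * a e) ∈ acc} ∂Pc ≤ 1 / 3 := by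
    rw [show (∫ ω, P.real {a | (ω, fun k => ∑ e, r ω k e * a e) ∈ acc} ∂Pc) = _ from
      (hswap _ h0).symm]
    calc _ ≤ ∫ _, (1 / 3 : ℝ) ∂P :=
          integral_mono_ae (integrable_real_section_right Pc P h0) (integrable_const _) hno
      _ = 1 / 3 := by simp
  have hyes' : ∀ j, 2 / 3 ≤
      ∫ ω, P.real {a | (ω, fun k => ∑ e, r ω k e * eraseOn (W j) a e) ∈ acc} ∂Pc := by
    intro j
    rw [show (∫ ω, P.real {a | (ω, fun k => ∑ e, r ω k e * eraseOn (W j) a e) ∈ acc} ∂Pc) = _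
      from (hswap _ (hj j)).symm]
    calc (2 / 3 : ℝ) = ∫ _, (2 / 3 : ℝ) ∂P := by simp
      _ ≤ _ := integral_mono_ae (integrable_const _) (integrable_real_section_right Pc P (hj j))
          (hyes.mono fun a ha => ha j)
  have hi0 : Integrable (fun ω => P.real {a | (ω, fun k => ∑ e, r ω k e * a e) ∈ acc}) Pc :=
    integrable_real_section_left Pc P h0
  have hij : ∀ j, Integrable (fun ω => P.real
      {a | (ω, fun k => ∑ e, r ω k e * eraseOn (W j) a e) ∈ acc}) Pc :=
    fun j => integrable_real_section_left Pc P (hj j)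
  have hsum : ∑ j, (∫ ω, P.real {a | (ω, fun k => ∑ e, r ω k e * eraseOn (W j) a e) ∈ acc} ∂Pc -
      ∫ ω, P.real {a | (ω, fun k => ∑ e, r ω k e * a e) ∈ acc} ∂Pc) ≤
      Fintype.card κ / 6 + (48 * C + 2) * (m * q) := by
    have hd : ∀ j, Integrable (fun ω =>
        P.real {a | (ω, fun k => ∑ e, r ω k e * eraseOn (W j) a e) ∈ acc} -
          P.real {a | (ω, fun k => ∑ e, r ω k e * a e) ∈ acc}) Pc := fun j => (hij j).sub hi0
    simp_rw [← integral_sub (hij _) hi0]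
    rw [← integral_finsetSum _ fun j _ => hd j]
    calc _ ≤ ∫ _, ((Fintype.card κ : ℝ) / 6 + (48 * C + 2) * (m * q)) ∂Pc := by
          refine integral_mono (integrable_finsetSum _ fun j _ => hd j)
            (integrable_const _) fun ω => ?_
          have hAω : MeasurableSet (Prod.mk ω ⁻¹' acc) := measurable_prodMk_left hacc
          exact h.sum_real_erase_sub_real_le W hW (r ω) hAω
      _ = _ := by simp
  have hlow : (Fintype.card κ : ℝ) * (1 / 3) ≤
      ∑ j, (∫ ω, P.real {a | (ω, fun k => ∑ e, r ω k e * eraseOn (W j) a e) ∈ acc} ∂Pc -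
      ∫ ω, P.real {a | (ω, fun k => ∑ e, r ω k e * a e) ∈ acc} ∂Pc) := by
    calc (Fintype.card κ : ℝ) * (1 / 3) = ∑ _j : κ, (1 / 3 : ℝ) := by simp
      _ ≤ _ := Finset.sum_le_sum fun j _ => by linarith [hyes' j]
  -- The two bounds combine to `card κ / 3 ≤ card κ / 6 + (48 * C + 2) * (m * q)`.
  linarith

end IsProfile

/-! ### The quadratic forms and their erasures -/

theorem eLpNorm_natCast_eq_ofReal {α : Type*} [MeasurableSpace α] {P : Measure α} {f : α → ℝ}
    {m : ℕ} (hm : Even m) (hm0 : m ≠ 0) (hf : Measurable f)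
    (hi : Integrable (fun x => f x ^ m) P) :
    eLpNorm f m P = ENNReal.ofReal ((∫ x, f x ^ m ∂P) ^ (m : ℝ)⁻¹) := by
  have hm0' : (m : ℝ≥0∞) ≠ 0 := by exact_mod_cast hm0
  have hLp : MemLp f m P := by
    rw [← integrable_norm_rpow_iff hf.aestronglyMeasurable hm0' (ENNReal.natCast_ne_top m)]
    simpa [hm.pow_abs] using hi
  rw [hLp.eLpNorm_eq_integral_rpow_norm hm0' (ENNReal.natCast_ne_top m)]
  simp [hm.pow_abs]

/-- The quadratic form `s ∑_{i < j} a_ij x_i x_j`. -/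
def triangularForm {n : ℕ} (s : ℝ) (a : Fin n × Fin n → ℝ) (x : Fin n → ℝ) : ℝ :=
  ∑ p, (if p.1 < p.2 then s * (x p.1 * x p.2) else 0) * a p

/-- The coefficients of `triangularForm`. -/
def triangularCoeff {n : ℕ} (s : ℝ) (a : Fin n × Fin n → ℝ) (i j : Fin n) : ℝ :=
  if i < j then s * a (i, j) else 0

theorem triangularForm_eq {n : ℕ} (s : ℝ) (a : Fin n × Fin n → ℝ) (x : Fin n → ℝ) :
    triangularForm s a x = ∑ i, ∑ j, triangularCoeff s a i j * (x i * x j) := by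
  rw [triangularForm, Fintype.sum_prod_type]
  refine Finset.sum_congr rfl fun i _ => Finset.sum_congr rfl fun j _ => ?_
  simp only [triangularCoeff]
  split_ifs <;> ring

theorem measurable_triangularForm {n : ℕ} (s : ℝ) (a : Fin n × Fin n → ℝ) :
    Measurable (triangularForm s a) := by
  simp_rw [funext (triangularForm_eq s a)]
  fun_prop

theorem isQuadratic_triangularForm {n : ℕ} (s : ℝ) (a : Fin n × Fin n → ℝ) :
    IsQuadratic (triangularForm s a) := by
  refine ⟨∑ i, ∑ j, MvPolynomial.C (triangularCoeff s a i j) *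
    (MvPolynomial.X i * MvPolynomial.X j), ?_, fun x => ?_⟩
  · refine MvPolynomial.totalDegree_finsetSum_le fun i _ =>
      MvPolynomial.totalDegree_finsetSum_le fun j _ => ?_
    refine (MvPolynomial.totalDegree_mul _ _).trans ?_
    rw [MvPolynomial.totalDegree_C, zero_add]
    refine (MvPolynomial.totalDegree_mul _ _).trans ?_
    simp
  · simp [triangularForm_eq]

/-- The coefficient positions that involve the variable `k`. -/
def starAt {n : ℕ} (k : Fin n) : Finset (Fin n × Fin n) :=
  Finset.univ.filter fun p => p.1 = k ∨ p.2 = k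

theorem card_filter_mem_starAt_le {n : ℕ} (p : Fin n × Fin n) :
    (Finset.univ.filter fun k => p ∈ starAt k).card ≤ 2 := by
  refine (Finset.card_le_card (t := {p.1, p.2}) fun k hk => ?_).trans Finset.card_le_two
  simpa [starAt, eq_comm] using hk

theorem triangularForm_eraseOn_starAt_congr {n : ℕ} (s : ℝ) (a : Fin n × Fin n → ℝ) (k : Fin n)
    (x y : Fin n → ℝ) (h : ∀ i, i ≠ k → x i = y i) :
    triangularForm s (eraseOn (starAt k) a) x = triangularForm s (eraseOn (starAt k) a) y := by
  refine Finset.sum_congr rfl fun p _ => ?_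
  by_cases hp : p ∈ starAt k
  · simp [eraseOn, hp]
  · simp only [starAt, Finset.mem_filter, Finset.mem_univ, true_and, not_or] at hp
    rw [h _ hp.1, h _ hp.2]

/-- After the erasure `x k` no longer occurs, so the part `{k}` with `F₁ = 0` works; `F₂` is the
form itself with `0` inserted at `k`. -/
theorem twoPartitionError_eq_zero {n : ℕ} (hn : 2 ≤ n) (μ : Fin n → Measure ℝ)
    (s : ℝ) (a : Fin n × Fin n → ℝ) (k : Fin n) :
    twoPartitionError μ (triangularForm s (eraseOn (starAt k) a)) = 0 := by
  classical
  have hk : (({k} : Set (Fin n))ᶜ).Nonempty := by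
    have : Nontrivial (Fin n) := Fin.nontrivial_iff_two_le.2 hn
    obtain ⟨j, hj⟩ := exists_ne k
    exact ⟨j, hj⟩
  let F := triangularForm s (eraseOn (starAt k) a)
  let E : (↥({k} : Set (Fin n))ᶜ → ℝ) → Fin n → ℝ := fun y i =>
    if h : i ∈ ({k} : Set (Fin n))ᶜ then y ⟨i, h⟩ else 0
  have hE : Measurable E := by
    refine measurable_pi_iff.2 fun i => ?_
    by_cases h : i ∈ ({k} : Set (Fin n))ᶜ
    · simpa only [E, dif_pos h] using measurable_pi_apply _
    · simpa only [E, dif_neg h] using measurable_const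
  refine le_antisymm ?_ zero_le
  refine (iInf₂_le_of_le {k} (Set.singleton_nonempty k) (iInf_le_of_le hk ?_))
  refine iInf₂_le_of_le 0 (F ∘ E) (iInf₂_le_of_le measurable_const
    ((measurable_triangularForm _ _).comp hE) ?_)
  have : (fun x : Fin n → ℝ => F x - (0 : (↥({k} : Set (Fin n)) → ℝ) → ℝ) (fun i => x i) -
      (F ∘ E) fun i => x i) = 0 := by
    funext x
    simp only [Pi.zero_apply, sub_zero, Function.comp_apply, sub_eq_zero]
    refine triangularForm_eraseOn_starAt_congr s a k _ _ fun i hi => ?_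
    simp [E, hi]
  rw [this, eLpNorm_zero]

/-- The mixed second difference of a quadratic form across a cut. -/
theorem sum_mixed_difference {n : ℕ} (S : Finset (Fin n)) (c : Fin n → Fin n → ℝ)
    (y z : Fin n → ℝ) :
    ∑ i, ∑ j, c i j * (y i * y j)
      - ∑ i, ∑ j, c i j * (S.piecewise y z i * S.piecewise y z j)
      - ∑ i, ∑ j, c i j * (S.piecewise z y i * S.piecewise z y j)
      + ∑ i, ∑ j, c i j * (z i * z j) =
    ∑ i ∈ S, (y i - z i) * ∑ j ∈ Sᶜ, (y j - z j) * (c i j + c j i) := by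
  have hR : ∑ i ∈ S, (y i - z i) * ∑ j ∈ Sᶜ, (y j - z j) * (c i j + c j i) =
      ∑ i, ∑ j, (if i ∈ S ∧ j ∉ S then c i j * ((y i - z i) * (y j - z j)) else 0) +
      ∑ i, ∑ j, (if j ∈ S ∧ i ∉ S then c i j * ((y i - z i) * (y j - z j)) else 0) := by
    rw [Finset.sum_comm (f := fun i j => if j ∈ S ∧ i ∉ S then _ else _),
      ← Finset.sum_add_distrib, ← Finset.sum_subset (Finset.subset_univ S)]
    · refine Finset.sum_congr rfl fun i hi => ?_
      rw [Finset.mul_sum, ← Finset.sum_add_distrib, ← Finset.sum_subset (Finset.subset_univ Sᶜ)]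
      · refine Finset.sum_congr rfl fun j hj => ?_
        rw [Finset.mem_compl] at hj
        simp only [hi, hj, not_false_eq_true, and_self, if_true]
        ring
      · intro j _ hj
        rw [Finset.mem_compl, not_not] at hj
        simp [hj]
    · intro i _ hi
      simp [hi]
  rw [hR]
  simp only [← Finset.sum_sub_distrib, ← Finset.sum_add_distrib]
  refine Finset.sum_congr rfl fun i _ => Finset.sum_congr rfl fun j _ => ?_
  by_cases hi : i ∈ S <;> by_cases hj : j ∈ S <;> simp [hi, hj] <;> ring

/-! ### Lower bound for the partition error -/

section Cost

variable {n : ℕ} (μ : Fin n → Measure ℝ) [∀ i, IsProbabilityMeasure (μ i)]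

/-- The law of the difference of two independent samples. -/
noncomputable def diffLaw (P : Measure ℝ) : Measure ℝ :=
  (P.prod P).map fun p => p.1 - p.2

instance (P : Measure ℝ) [IsProbabilityMeasure P] : IsProbabilityMeasure (diffLaw P) :=
  Measure.isProbabilityMeasure_map (by fun_prop)

theorem diffLaw_moments {P : Measure ℝ} [IsProbabilityMeasure P]
    (hi : Integrable (fun x : ℝ => x ^ 2) P) (h1 : ∫ x, x ∂P = 0) (h2 : ∫ x, x ^ 2 ∂P = 1) :
    ∫ x, x ∂diffLaw P = 0 ∧ ∫ x, x ^ 2 ∂diffLaw P = 2 ∧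
      Integrable (fun x : ℝ => x ^ 2) (diffLaw P) := by
  have hm : Measurable fun p : ℝ × ℝ => p.1 - p.2 := by fun_prop
  have hi1 : Integrable (fun x : ℝ => x) P := by
    simpa using integrable_pow_of_le one_le_two even_two hi
  have j1 := hi1.comp_fst P
  have j2 := hi1.comp_snd P
  have k1 : Integrable (fun p : ℝ × ℝ => p.1 ^ 2) (P.prod P) := hi.comp_fst P
  have k2 : Integrable (fun p : ℝ × ℝ => p.2 ^ 2) (P.prod P) := hi.comp_snd P
  have k3 : Integrable (fun p : ℝ × ℝ => p.1 * p.2) (P.prod P) := hi1.mul_prod hi1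
  have k4 : Integrable (fun p : ℝ × ℝ => p.1 ^ 2 + p.2 ^ 2) (P.prod P) := k1.add k2
  have e : ∀ p : ℝ × ℝ, (p.1 - p.2) ^ 2 = p.1 ^ 2 + p.2 ^ 2 - 2 * (p.1 * p.2) := fun p => by ring
  refine ⟨?_, ?_, ?_⟩
  · rw [diffLaw, integral_map hm.aemeasurable (by fun_prop), integral_sub j1 j2,
      integral_fun_fst (fun x => x), integral_fun_snd (fun x => x), h1]
    simp
  · rw [diffLaw, integral_map hm.aemeasurable (by fun_prop)]
    simp_rw [e]
    rw [integral_sub k4 (k3.const_mul 2), integral_add k1 k2, integral_const_mul,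
      integral_prod_mul (fun x => x) (fun x => x), integral_fun_fst (fun x => x ^ 2),
      integral_fun_snd (fun x => x ^ 2), h1, h2]
    simp; norm_num
  · rw [diffLaw, integrable_map_measure (by fun_prop) hm.aemeasurable]
    refine (k4.sub (k3.const_mul 2)).congr (.of_forall fun p => ?_)
    exact (e p).symm

variable {μ}

/-- A lower bound for the `L²` norm of a bilinear form across a cut with coefficients bounded away
from zero. -/
theorem le_eLpNorm_cutForm {v : ℝ} (hv : 0 ≤ v)
    (hi : ∀ i, Integrable (fun x : ℝ => x ^ 2) (μ i))
    (h1 : ∀ i, ∫ x, x ∂μ i = 0) (h2 : ∀ i, ∫ x, x ^ 2 ∂μ i = v) (S : Finset (Fin n))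
    (hS : S.Nonempty) (hS' : Sᶜ.Nonempty) (c : Fin n → Fin n → ℝ) {s : ℝ} (hs : 0 ≤ s)
    (hc : ∀ i ∈ S, ∀ j ∈ Sᶜ, s ≤ |c i j|) :
    ENNReal.ofReal (v * s * √((n : ℝ) - 1)) ≤
      eLpNorm (fun x => ∑ i ∈ S, x i * ∑ j ∈ Sᶜ, x j * c i j) 2 (Measure.pi μ) := by
  have hin : ∀ i, Integrable (fun x => (∑ j ∈ Sᶜ, x j * c i j) ^ 2) (Measure.pi μ) ∧
      ∫ x, (∑ j ∈ Sᶜ, x j * c i j) ^ 2 ∂Measure.pi μ = v * ∑ j ∈ Sᶜ, c i j ^ 2 := fun i => by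
    simpa using integral_sum_mul_sq h1 h2 hi Sᶜ (fun j _ => c i j) (fun _ => measurable_const)
      (fun _ _ => integrable_const _) fun _ _ _ _ _ _ => rfl
  have hm : ∀ i, Measurable fun x : Fin n → ℝ => ∑ j ∈ Sᶜ, x j * c i j := fun i => by fun_prop
  obtain ⟨hI, hE⟩ := integral_sum_mul_sq h1 h2 hi S (fun i x => ∑ j ∈ Sᶜ, x j * c i j) hm
    (fun i _ => (hin i).1) fun i _ k hk x t => Finset.sum_congr rfl fun j hj => by
      rw [Function.update_of_ne (ne_of_mem_of_not_mem hk (Finset.mem_compl.1 hj)).symm]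
  have hm' : Measurable fun x : Fin n → ℝ => ∑ i ∈ S, x i * ∑ j ∈ Sᶜ, x j * c i j := by fun_prop
  have := eLpNorm_natCast_eq_ofReal even_two two_ne_zero hm' hI
  rw [Nat.cast_ofNat] at this
  rw [this, hE]
  refine ENNReal.ofReal_le_ofReal ?_
  rw [Nat.cast_ofNat, ← one_div, ← Real.sqrt_eq_rpow]
  refine Real.le_sqrt_of_sq_le ?_
  -- The number of separated pairs is least when one side is a singleton: `(|S| - 1)(|Sᶜ| - 1) ≥ 0`.
  have hcard : (n : ℝ) - 1 ≤ S.card * Sᶜ.card := by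
    have e1 : (S.card : ℝ) + Sᶜ.card = n := by
      exact_mod_cast (Finset.card_add_card_compl S).trans (Fintype.card_fin n)
    have e2 : (1 : ℝ) ≤ S.card := by exact_mod_cast hS.card_pos
    have e3 : (1 : ℝ) ≤ Sᶜ.card := by exact_mod_cast hS'.card_pos
    nlinarith
  have hn1 : (0 : ℝ) ≤ (n : ℝ) - 1 := by
    have : 1 ≤ n := by
      obtain ⟨i, _⟩ := hS
      exact Nat.one_le_iff_ne_zero.2 (Nat.ne_of_gt i.pos)
    have : (1 : ℝ) ≤ n := by exact_mod_cast this
    linarith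
  have hlow : (S.card : ℝ) * (Sᶜ.card * s ^ 2) ≤ ∑ i ∈ S, ∑ j ∈ Sᶜ, c i j ^ 2 := by
    rw [← nsmul_eq_mul, ← nsmul_eq_mul, ← Finset.sum_const, ← Finset.sum_const]
    refine Finset.sum_le_sum fun i hi => Finset.sum_le_sum fun j hj => ?_
    rw [← sq_abs (c i j)]
    exact pow_le_pow_left₀ hs (hc i hi j hj) 2
  simp_rw [fun i => (hin i).2]
  rw [← Finset.mul_sum, mul_pow, Real.sq_sqrt hn1, mul_pow]
  calc v ^ 2 * s ^ 2 * ((n : ℝ) - 1) ≤ v ^ 2 * s ^ 2 * (S.card * Sᶜ.card) := by gcongr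
    _ = v * (v * (S.card * (Sᶜ.card * s ^ 2))) := by ring
    _ ≤ _ := by gcongr

theorem measurePreserving_select (S : Finset (Fin n)) :
    MeasurePreserving (fun z : Fin n → ℝ × ℝ => S.piecewise (fun i => (z i).1) fun i => (z i).2)
      (Measure.pi fun i => (μ i).prod (μ i)) (Measure.pi μ) := by
  have := measurePreserving_pi (fun i => (μ i).prod (μ i)) μ
    (f := fun i p => if i ∈ S then p.1 else p.2) fun i => by
      by_cases hi : i ∈ S
      · simpa only [hi, if_true] using measurePreserving_fst
      · simpa only [hi, if_false] using measurePreserving_snd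
  exact this

/-- Take two independent samples and mix them along the cut in all four ways. The alternating sum
cancels `F₁` and `F₂` and leaves the cut part of the form at the difference of the samples, whose
coordinates have variance `2`. Each of the four terms has the law of the residual `G`, so `2 s
√(n-1) ≤ 4 ‖G‖₂`. No integrability of `F₁` or `F₂` is needed. -/
theorem ofReal_le_twoPartitionError
    (hi : ∀ i, Integrable (fun x : ℝ => x ^ 2) (μ i))
    (h1 : ∀ i, ∫ x, x ∂μ i = 0) (h2 : ∀ i, ∫ x, x ^ 2 ∂μ i = 1) {s : ℝ} (hs : 0 ≤ s)
    {a : Fin n × Fin n → ℝ} (ha : ∀ p, 1 ≤ |a p|) :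
    ENNReal.ofReal (s * √((n : ℝ) - 1) / 2) ≤ twoPartitionError μ (triangularForm s a) := by
  classical
  refine le_iInf₂ fun S hS => le_iInf fun hS' => le_iInf₂ fun F₁ F₂ => le_iInf₂ fun hF₁ hF₂ => ?_
  set F := triangularForm s a with hF
  have hFm : Measurable F := measurable_triangularForm s a
  let c := triangularCoeff s a
  let D : Finset (Fin n) := Finset.univ.filter (· ∈ S)
  have hD : ∀ i, i ∈ D ↔ i ∈ S := fun i => by simp [D]
  set G : (Fin n → ℝ) → ℝ := fun x => F x - F₁ (fun i => x i) - F₂ (fun i => x i) with hG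
  have hGm : Measurable G := by
    refine (hFm.sub (hF₁.comp ?_)).sub (hF₂.comp ?_) <;>
    exact measurable_pi_iff.2 fun i => measurable_pi_apply _
  let Q : Measure (Fin n → ℝ × ℝ) := Measure.pi fun i => (μ i).prod (μ i)
  let sel : Finset (Fin n) → (Fin n → ℝ × ℝ) → Fin n → ℝ := fun A z =>
    A.piecewise (fun i => (z i).1) fun i => (z i).2
  have hsel : ∀ A, MeasurePreserving (sel A) Q (Measure.pi μ) := fun A =>
    measurePreserving_select A
  have hGs : ∀ A, eLpNorm (G ∘ sel A) 2 Q = eLpNorm G 2 (Measure.pi μ) := fun A =>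
    eLpNorm_comp_measurePreserving hGm.aestronglyMeasurable (hsel A)
  have hGa : ∀ A, AEStronglyMeasurable (G ∘ sel A) Q := fun A =>
    (hGm.comp (hsel A).measurable).aestronglyMeasurable
  let H : (Fin n → ℝ × ℝ) → ℝ :=
    G ∘ sel Finset.univ - G ∘ sel D - G ∘ sel Dᶜ + G ∘ sel ∅
  have hH4 : eLpNorm H 2 Q ≤ 4 * eLpNorm G 2 (Measure.pi μ) := by
    have t1 := eLpNorm_add_le (((hGa Finset.univ).sub (hGa D)).sub (hGa Dᶜ)) (hGa ∅)
      (p := 2) one_le_two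
    have t2 := eLpNorm_sub_le ((hGa Finset.univ).sub (hGa D)) (hGa Dᶜ) (p := 2) one_le_two
    have t3 := eLpNorm_sub_le (hGa Finset.univ) (hGa D) (p := 2) one_le_two
    simp only [hGs] at t1 t2 t3
    calc eLpNorm H 2 Q ≤ eLpNorm G 2 (Measure.pi μ) + eLpNorm G 2 (Measure.pi μ) +
          eLpNorm G 2 (Measure.pi μ) + eLpNorm G 2 (Measure.pi μ) :=
        t1.trans (add_le_add_left (t2.trans (add_le_add_left t3 _)) _)
      _ = 4 * eLpNorm G 2 (Measure.pi μ) := by ring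
  let L : (Fin n → ℝ) → ℝ := fun x => ∑ i ∈ D, x i * ∑ j ∈ Dᶜ, x j * (c i j + c j i)
  let d : (Fin n → ℝ × ℝ) → Fin n → ℝ := fun z i => (z i).1 - (z i).2
  have hd : MeasurePreserving d Q (Measure.pi fun i => diffLaw (μ i)) :=
    measurePreserving_pi (fun i => (μ i).prod (μ i)) (fun i => diffLaw (μ i))
      (f := fun i p => p.1 - p.2) fun i => ⟨by fun_prop, rfl⟩
  have hHL : H = L ∘ d := by
    funext z
    have u1 : sel Finset.univ z = fun i => (z i).1 := by simp [sel]
    have u2 : sel ∅ z = fun i => (z i).2 := by simp [sel]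
    have u3 : sel Dᶜ z = D.piecewise (fun i => (z i).2) fun i => (z i).1 := by
      funext i
      by_cases h : i ∈ D <;> simp [sel, h]
    have f1 : (fun i : S => sel D z i) = fun i : S => (z i).1 := by
      funext i; simp [sel, hD]
    have f2 : (fun i : S => sel Dᶜ z i) = fun i : S => (z i).2 := by
      funext i; simp [sel, hD]
    have f3 : (fun i : ↥Sᶜ => sel D z i) = fun i : ↥Sᶜ => (z i).2 := by
      funext i
      have : (i : Fin n) ∉ S := i.2
      simp [sel, hD, this]
    have f4 : (fun i : ↥Sᶜ => sel Dᶜ z i) = fun i : ↥Sᶜ => (z i).1 := by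
      funext i
      have : (i : Fin n) ∉ S := i.2
      simp [sel, hD, this]
    have key := sum_mixed_difference D c (fun i => (z i).1) fun i => (z i).2
    simp only [H, Pi.add_apply, Pi.sub_apply, Function.comp_apply, hG, f1, f2, f3, f4]
    rw [u1, u2, u3]
    simp only [hF, triangularForm_eq]
    simp only [L, d]
    rw [← key]
    simp only [sel, c]
    ring
  have hLm : Measurable L := by fun_prop
  have hmom := fun i => diffLaw_moments (hi i) (h1 i) (h2 i)
  have hDne : D.Nonempty := hS.imp fun i hi => (hD i).2 hi
  have hDne' : Dᶜ.Nonempty := hS'.imp fun i hi => Finset.mem_compl.2 fun h => hi ((hD i).1 h)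
  have hlow := le_eLpNorm_cutForm (μ := fun i => diffLaw (μ i)) zero_le_two
    (fun i => (hmom i).2.2) (fun i => (hmom i).1) (fun i => (hmom i).2.1) D hDne hDne'
    (fun i j => c i j + c j i) hs fun i hi j hj => by
      have hij : i ≠ j := fun h => Finset.mem_compl.1 hj (h ▸ hi)
      have hsa : ∀ p, s ≤ |s * a p| := fun p => by
        rw [abs_mul, abs_of_nonneg hs]
        exact le_mul_of_one_le_right hs (ha p)
      -- Exactly one of `(i, j)` and `(j, i)` is above the diagonal, so there is no cancellation in
      -- `c i j + c j i`.
      rcases lt_or_gt_of_ne hij with h | h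
      · simpa [c, triangularCoeff, h, h.not_gt] using hsa (i, j)
      · simpa [c, triangularCoeff, h, h.not_gt] using hsa (j, i)
  have hfin : ENNReal.ofReal (2 * s * √((n : ℝ) - 1)) ≤ 4 * eLpNorm G 2 (Measure.pi μ) := by
    refine hlow.trans (le_trans (le_of_eq ?_) hH4)
    rw [hHL, eLpNorm_comp_measurePreserving hLm.aestronglyMeasurable hd]
  have h4 : ENNReal.ofReal (2 * s * √((n : ℝ) - 1)) =
      4 * ENNReal.ofReal (s * √((n : ℝ) - 1) / 2) := by
    rw [← ENNReal.ofReal_ofNat 4, ← ENNReal.ofReal_mul (by norm_num)]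
    congr 1; ring
  rw [h4] at hfin
  exact (ENNReal.mul_le_mul_iff_right (by norm_num) (by norm_num)).1 hfin

/-! ### Normalisation in `L⁴` and the query bound -/

/-- Grouping by the larger index writes the form as `∑ x k * B k`, with `B k` linear in the earlier
variables. The fourth moment bound, applied to each `B k` and then to the sum, gives `K² (2 s n)⁴`.
-/
theorem eLpNorm_four_triangularForm_le_one {M : ℝ} (hM : 0 ≤ M)
    (hi : ∀ i, Integrable (fun x : ℝ => x ^ 4) (μ i))
    (h1 : ∀ i, ∫ x, x ∂μ i = 0) (h2 : ∀ i, ∫ x, x ^ 2 ∂μ i = 1)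
    (h3 : ∀ i, |∫ x, x ^ 3 ∂μ i| ≤ M) (h4 : ∀ i, ∫ x, x ^ 4 ∂μ i ≤ M)
    {s : ℝ} (hs : 0 ≤ s) (hsn : 2 * s * n * fourthMomentConst M ≤ 1)
    {a : Fin n × Fin n → ℝ} (ha : ∀ p, |a p| ≤ 2) :
    eLpNorm (triangularForm s a) 4 (Measure.pi μ) ≤ 1 := by
  set K := fourthMomentConst M with hK
  have hK1 : 1 ≤ K := by rw [hK, fourthMomentConst]; nlinarith
  let B : Fin n → (Fin n → ℝ) → ℝ := fun k x => ∑ i ∈ Finset.Iio k, x i * (s * a (i, k))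
  have hBm : ∀ k, Measurable (B k) := fun k => by fun_prop
  have hc : ∀ p, (s * a p) ^ 4 ≤ (2 * s) ^ 4 := fun p => by
    have ev : Even 4 := by decide
    rw [← ev.pow_abs, abs_mul, abs_of_nonneg hs, mul_comm 2]
    exact pow_le_pow_left₀ (by positivity) (mul_le_mul_of_nonneg_left (ha p) hs) 4
  have hB : ∀ k, Integrable (fun x => B k x ^ 4) (Measure.pi μ) ∧
      ∫ x, B k x ^ 4 ∂Measure.pi μ ≤ K * (2 * s) ^ 4 * (n : ℝ) ^ 2 := by
    intro k
    obtain ⟨e1, e2⟩ := integral_sum_mul_pow_four_le hM (b := (2 * s) ^ 4) (by positivity) hi h1 h2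
      h3 h4 (Finset.Iio k) (fun i _ => s * a (i, k)) (fun _ => measurable_const)
      (fun _ => integrable_const _) (fun i => by simpa using hc (i, k)) fun _ _ _ _ _ => rfl
    refine ⟨e1, e2.trans ?_⟩
    have : ((Finset.Iio k).card : ℝ) ≤ n := by
      exact_mod_cast (Finset.card_le_univ _).trans (Fintype.card_fin n).le
    gcongr
  have hBu : ∀ k j, k ≤ j → ∀ x t, B k (Function.update x j t) = B k x := by
    intro k j hkj x t
    refine Finset.sum_congr rfl fun i hik => ?_
    rw [Function.update_of_ne (ne_of_lt ((Finset.mem_Iio.1 hik).trans_le hkj))]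
  obtain ⟨hI, hE⟩ := integral_sum_mul_pow_four_le hM (by positivity) hi h1 h2 h3 h4 Finset.univ B
    hBm (fun k => (hB k).1) (fun k => (hB k).2) hBu
  have hform : ∀ x, ∑ k, x k * B k x = triangularForm s a x := by
    intro x
    rw [triangularForm_eq, Finset.sum_comm]
    refine Finset.sum_congr rfl fun k _ => ?_
    simp only [B, Finset.mul_sum]
    rw [← Finset.sum_subset (Finset.subset_univ (Finset.Iio k))]
    · refine Finset.sum_congr rfl fun i hik => ?_
      rw [triangularCoeff, if_pos (Finset.mem_Iio.1 hik)]; ring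
    · intro i _ hik
      rw [triangularCoeff, if_neg fun h => hik (Finset.mem_Iio.2 h), zero_mul]
  simp_rw [hform] at hI hE
  have := eLpNorm_natCast_eq_ofReal (m := 4) (by decide) (by norm_num)
    (measurable_triangularForm s a) hI
  rw [Nat.cast_ofNat] at this
  rw [this, ENNReal.ofReal_le_one]
  refine Real.rpow_le_one (integral_nonneg fun x => by positivity) ?_ (by positivity)
  refine hE.trans ?_
  rw [Finset.card_univ, Fintype.card_fin]
  calc K * (K * (2 * s) ^ 4 * (n : ℝ) ^ 2) * (n : ℝ) ^ 2 = K ^ 2 * (2 * s * n) ^ 4 := by ring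
    _ ≤ K ^ 4 * (2 * s * n) ^ 4 := by
        gcongr
        norm_num
    _ = (2 * s * n * K) ^ 4 := by ring
    _ ≤ 1 := pow_le_one₀ (by positivity) hsn

/-- If a class of functions contains all the forms with coefficients of size at most `2 s`, then
testing `2`-partitionability on it with a small enough proximity parameter takes linearly many
queries. -/
theorem natCast_le_of_testsTwoPartitionability {φ : ℝ → ℝ} {C : ℝ} (h : IsProfile φ C)
    (hn : 2 ≤ n) (hi : ∀ i, Integrable (fun x : ℝ => x ^ 2) (μ i))
    (h1 : ∀ i, ∫ x, x ∂μ i = 0) (h2 : ∀ i, ∫ x, x ^ 2 ∂μ i = 1)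
    {Ω : Type*} [MeasurableSpace Ω] {q : ℕ} (T : NonadaptiveTester Ω n q) {ε s : ℝ} (hs : 0 < s)
    (hε : ε < s * √((n : ℝ) - 1) / 2) {Cl : Set ((Fin n → ℝ) → ℝ)}
    (hCl : ∀ a : Fin n × Fin n → ℝ, (∀ p, |a p| ≤ 2) → triangularForm s a ∈ Cl)
    (hT : T.TestsTwoPartitionability μ Cl ε) :
    (n : ℝ) ≤ 12 * (48 * C + 2) * q := by
  have := h.isProbabilityMeasure
  have := T.isProbabilityMeasure_coins
  have hn1 : (0 : ℝ) < (n : ℝ) - 1 := by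
    have : (2 : ℝ) ≤ n := by exact_mod_cast hn
    linarith
  have hae : ∀ᵐ a ∂Measure.pi fun _ : Fin n × Fin n => sqDensity φ,
      ∀ p, 1 ≤ |a p| ∧ |a p| ≤ 2 :=
    ae_all_iff.2 fun p =>
      (measurePreserving_eval (fun _ : Fin n × Fin n => sqDensity φ)
        p).quasiMeasurePreserving.ae h.ae_abs_mem
  have key := h.card_le_of_distinguishes (q := q) (m := 2) (starAt (n := n))
    card_filter_mem_starAt_le T.coins
    -- The value of the form at a query is linear in `a`, with these coefficients.
    (fun ω k p => if p.1 < p.2 then s * (T.query ω k p.1 * T.query ω k p.2) else 0)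
    (fun k p => by
      have hq : ∀ i, Measurable fun ω => T.query ω k i := fun i =>
        (measurable_pi_apply i).comp ((measurable_pi_apply k).comp T.measurable_query)
      by_cases hp : p.1 < p.2
      · simp only [hp, if_true]
        exact ((hq _).mul (hq _)).const_mul s
      · simpa only [hp, if_false] using measurable_const)
    T.measurableSet_accept
    (by
      filter_upwards [hae] with a ha
      refine (hT (triangularForm s a) (hCl a fun p => (ha p).2)).2 ?_
      refine lt_of_lt_of_le ?_ (ofReal_le_twoPartitionError hi h1 h2 hs.le fun p => (ha p).1)
      exact (ENNReal.ofReal_lt_ofReal_iff (by positivity)).2 hε)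
    (by
      filter_upwards [hae] with a ha k
      refine (hT (triangularForm s (eraseOn (starAt k) a)) (hCl _ fun p => ?_)).1
        (twoPartitionError_eq_zero hn μ s a k)
      by_cases hp : p ∈ starAt k
      · simp [eraseOn, hp]
      · simpa [eraseOn, hp] using (ha p).2)
  rw [Fintype.card_fin] at key
  push_cast at key
  linarith

end Cost

theorem mainTheorem5 :
    ∃ c : ℝ, 0 < c ∧ ∀ M : ℝ, ∃ η : ℝ, 0 < η ∧
      ∀ n : ℕ, 2 ≤ n → ∀ μ : Fin n → Measure ℝ,
        (∀ i, IsProbabilityMeasure (μ i)) →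
        (∀ i, Integrable (fun x : ℝ => x ^ 4) (μ i)) →
        (∀ i, ∫ x, x ∂(μ i) = 0) →
        (∀ i, ∫ x, x ^ 2 ∂(μ i) = 1) →
        (∀ i, |∫ x, x ^ 3 ∂(μ i)| ≤ M) →
        (∀ i, ∫ x, x ^ 4 ∂(μ i) ≤ M) →
        ∀ (Ω : Type*) [MeasurableSpace Ω] (q : ℕ) (T : NonadaptiveTester Ω n q) (ε : ℝ), 0 < ε →
          (T.TestsTwoPartitionability μ {F | IsQuadratic F} ε → c * n ≤ q) ∧
          (ε ≤ η / √(n : ℝ) →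
            T.TestsTwoPartitionability μ
              {F | IsQuadratic F ∧ eLpNorm F 4 (Measure.pi μ) ≤ 1} ε → c * n ≤ q) := by
  obtain ⟨φ, C, h⟩ := exists_isProfile
  have hC := h.const_nonneg
  refine ⟨(12 * (48 * C + 2))⁻¹, by positivity, fun M => ?_⟩
  have hK : 0 < fourthMomentConst |M| := by unfold fourthMomentConst; positivity
  -- With `s = 1/(2nK)`, the largest scale allowed by the `L⁴` bound, the partition error is at
  -- least `s√n/4 = 1/(8K√n)`. Half of that is used, for a strict inequality. The absolute value
  -- keeps `K` positive for every `M`.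
  refine ⟨1 / (16 * fourthMomentConst |M|), by positivity, ?_⟩
  intro n hn μ hμ hi h1 h2 h3 h4 Ω _ q T ε hε
  have hn2 : (2 : ℝ) ≤ n := by exact_mod_cast hn
  have hi2 : ∀ i, Integrable (fun x : ℝ => x ^ 2) (μ i) := fun i =>
    integrable_pow_of_le (by norm_num) (by decide) (hi i)
  have hconcl : (n : ℝ) ≤ 12 * (48 * C + 2) * q → (12 * (48 * C + 2))⁻¹ * (n : ℝ) ≤ q :=
    fun hq => (inv_mul_le_iff₀ (by positivity)).2 hq
  constructor
  · intro hT
    -- Without a norm constraint the form can be scaled freely; `s = 2 * ε + 2` makes `s / 2` exceed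
    -- `ε`.
    refine hconcl (natCast_le_of_testsTwoPartitionability h hn hi2 h1 h2 T (s := 2 * ε + 2)
      (by positivity) ?_ (fun a _ => isQuadratic_triangularForm _ a) hT)
    have : 1 ≤ √((n : ℝ) - 1) := Real.one_le_sqrt.2 (by linarith)
    nlinarith
  · intro hη hT
    have hn0 : (0 : ℝ) < n := by linarith
    have hs0 : 0 < √(n : ℝ) := Real.sqrt_pos.2 hn0
    refine hconcl (natCast_le_of_testsTwoPartitionability h hn hi2 h1 h2 T
      (s := 1 / (2 * n * fourthMomentConst |M|)) (by positivity)
      (Cl := {F | IsQuadratic F ∧ eLpNorm F 4 (Measure.pi μ) ≤ 1}) ?_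
      (fun a ha => ⟨isQuadratic_triangularForm _ a, ?_⟩) hT)
    · refine hη.trans_lt ?_
      have hsq : √(n : ℝ) / 2 ≤ √((n : ℝ) - 1) := by
        refine Real.le_sqrt_of_sq_le ?_
        rw [div_pow, Real.sq_sqrt hn0.le]; linarith
      calc 1 / (16 * fourthMomentConst |M|) / √(n : ℝ)
          < 1 / (8 * fourthMomentConst |M|) / √(n : ℝ) := by gcongr; norm_num
        _ = 1 / (2 * n * fourthMomentConst |M|) * (√(n : ℝ) / 2) / 2 := by
            have := Real.mul_self_sqrt hn0.le
            field_simp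
            nlinarith
        _ ≤ _ := by gcongr
    · refine eLpNorm_four_triangularForm_le_one (abs_nonneg M) hi h1 h2
        (fun i => (h3 i).trans (le_abs_self M)) (fun i => (h4 i).trans (le_abs_self M))
        (by positivity) (le_of_eq ?_) ha
      field_simp
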